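/- There are absolute constants $N_0>0$ and $c>0$ such that the following holds. Let $\mathcal T\subset\mathbb R^q$ be compact and let $\mathcal H_K$ be a reproducing kernel Hilbert space of real functions on $\mathcal T$ with norm $\|\cdot\|_K$ and measurable kernel $K$ satisfying $\sup_{t}K(t,t)\le 1$. Let $$Y_i=X_i'\beta^*+f^*(T_i)+\epsilon_i,\qquad i=1,\dots,n,$$ where the pairs $(X_i,T_i)\in\mathbb R^p\times\mathcal T$ are i.i.d. copies of $(X,T)$, the $\epsilon_i$ are i.i.d. standard normal and independent of the covariates, $\beta^*\in\mathbb R^p$ has exactly $s^*$ nonzero coordinates, and $f^*\in\mathcal H_K$ satisfies $\mathbb E f^*(T)=0$. For each $j$ let $g_j\in\mathcal H_K$ be a minimizer of $g\mapsto\mathbb E[(X^{(j)}-g(T))^2]$ over $\mathcal H_K$ (assumed to exist), and put $X_T=X-(g_1(T),\dots,g_p(T))'$. Assume: * $|X^{(j)}|\le C_0$ and $|X_T^{(j)}|\le C_K$ almost surely for all $j$, and $\|f^*\|_K\le C_K$; * the smallest eigenvalue $\tilde\Lambda_{\min}$ of $\mathbb E[X_TX_T']$ is positive; $\Lambda_K$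 denotes the largest eigenvalue of the matrix $(\langle g_k,g_l\rangle_K)_{k,l=1}^p$. Let $r_n>0$, $L_n\ge 0$, $\lambda_2\ge0$ and $\lambda_1$ satisfy $$\lambda_1\ge(2+5L_n)r_n+8N_0C_K\sqrt{(C_K+2)/n}+4C_K^2r_n,\qquad \lambda_2\Lambda_K/\tilde\Lambda_{\min}\le 1/2 .$$ Then, with probability at least $$1-2p^2\exp\Big(-\frac{cnr_n^2}{C_K^2(C_0+C_K)^2}\Big)-2p^2\exp\Big(-\frac{cnr_n^2}{4C_K^4}\Big)-3p\exp\Big(-\frac{cnr_n^2}{C_K^2}\Big)-p\exp(-nr_n^2),$$ every minimizer $(\hat\beta,\hat f)$ of $$\frac1{2n}\sum_{i=1}^n\big(Y_i-X_i'\beta-f(T_i)\big)^2+\lambda_1\|\beta\|_1+\frac{\lambda_2}{2}\|f\|_K^2$$ over $\{\beta\in\mathbb R^p:\|\beta-\beta^*\|_1\le L_n\}\times\mathcal H_K$ that satisfies $\|\hat f\|_K\le C_K$ obeys $$\|X_T'(\hat\beta-\beta^*)\|_2\le 2\sqrt{s^*/\tilde\Lambda_{\min}}\,\lambda_1+4\sqrt{\Lambda_K/\tilde\Lambda_{\min}}\,\big(C_K+\|f^*\|_K\big)\lambda_2,$$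 $$\|\hat\beta-\beta^*\|_1\le \frac{4s^*}{\tilde\Lambda_{\min}}\lambda_1+\frac{4\Lambda_K}{\tilde\Lambda_{\min}}\big(C_K+\|f^*\|_K\big)^2\,\frac{\lambda_2^2}{\lambda_1}.$$ Here $\|X_T'v\|_2=(v'\,\mathbb E[X_TX_T']\,v)^{1/2}$ is the population norm, evaluated at the vector $v=\hat\beta-\beta^*$. -/

import Mathlib

open MeasureTheory ProbabilityTheory

noncomputable section

namespace PLM

/-- The `ℓ₁`-norm of a vector of `ℝᵖ`. -/
def l1Norm {p : ℕ} (v : Fin p → ℝ) : ℝ := ∑ j, |v j|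

/-- The number of nonzero coordinates of a vector of `ℝᵖ`. -/
def sparsity {p : ℕ} (v : Fin p → ℝ) : ℕ := {j | v j ≠ 0}.ncard

/-- The real-valued reproducing kernel `K(s, t)` of a real reproducing kernel Hilbert space `H` of
functions on `𝒯`. (Mathlib's kernel takes values in the continuous linear maps `ℝ → ℝ`.) -/
def kernel {𝒯 : Type*} (H : Type*) [NormedAddCommGroup H] [InnerProductSpace ℝ H]
    [CompleteSpace H] [RKHS ℝ H 𝒯 ℝ] (s t : 𝒯) : ℝ :=
  RKHS.kernel H s t 1

/-- The partially linear model `Yᵢ = Xᵢ'β* + f*(Tᵢ) + εᵢ`, `i = 1, …, n`: the covariates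
`(Xᵢ, Tᵢ)` are i.i.d. with law `ρ`, the noise variables are i.i.d. standard normal and independent
of the covariates, and the nonparametric component `f*` has mean zero. -/
structure Model {Ω 𝒯 H : Type*} [MeasurableSpace Ω] [MeasurableSpace 𝒯]
    [NormedAddCommGroup H] [InnerProductSpace ℝ H] [RKHS ℝ H 𝒯 ℝ] {n p : ℕ}
    (μ : Measure Ω) (ρ : Measure ((Fin p → ℝ) × 𝒯))
    (X : Fin n → Ω → Fin p → ℝ) (T : Fin n → Ω → 𝒯) (ε Y : Fin n → Ω → ℝ)
    (βstar : Fin p → ℝ) (fstar : H) : Prop where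
  measurable_X : ∀ i, Measurable (X i)
  measurable_T : ∀ i, Measurable (T i)
  measurable_noise : ∀ i, Measurable (ε i)
  law_covariates : ∀ i, μ.map (fun ω => (X i ω, T i ω)) = ρ
  indep_covariates : iIndepFun (fun i ω => (X i ω, T i ω)) μ
  law_noise : ∀ i, μ.map (ε i) = gaussianReal 0 1
  indep_noise : iIndepFun ε μ
  indep_covariates_noise :
    IndepFun (fun ω i => (X i ω, T i ω)) (fun ω i => ε i ω) μ
  response : ∀ i ω, Y i ω = ∑ j, X i ω j * βstar j + fstar (T i ω) + ε i ω
  mean_zero : ∫ z, fstar z.2 ∂ρ = 0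

/-- The double-penalized least squares criterion
`(1 / 2n) ∑ᵢ (yᵢ - xᵢ'β - f(tᵢ))² + λ₁ ‖β‖₁ + (λ₂ / 2) ‖f‖_K²`. -/
def criterion {𝒯 H : Type*} [NormedAddCommGroup H] [InnerProductSpace ℝ H] [RKHS ℝ H 𝒯 ℝ]
    {n p : ℕ} (x : Fin n → Fin p → ℝ) (t : Fin n → 𝒯) (y : Fin n → ℝ) (lam₁ lam₂ : ℝ)
    (β : Fin p → ℝ) (f : H) : ℝ :=
  1 / (2 * (n : ℝ)) * ∑ i, (y i - ∑ j, x i j * β j - f (t i)) ^ 2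
    + lam₁ * l1Norm β + lam₂ / 2 * ‖f‖ ^ 2

/-- `(β, f)` minimizes the double-penalized criterion over all `β'` with `‖β' - β*‖₁ ≤ L` and all
`f'` in the RKHS. -/
def IsEstimator {𝒯 H : Type*} [NormedAddCommGroup H] [InnerProductSpace ℝ H] [RKHS ℝ H 𝒯 ℝ]
    {n p : ℕ} (x : Fin n → Fin p → ℝ) (t : Fin n → 𝒯) (y : Fin n → ℝ) (lam₁ lam₂ : ℝ)
    (βstar : Fin p → ℝ) (L : ℝ) (β : Fin p → ℝ) (f : H) : Prop :=
  l1Norm (β - βstar) ≤ L ∧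
    ∀ (β' : Fin p → ℝ) (f' : H), l1Norm (β' - βstar) ≤ L →
      criterion x t y lam₁ lam₂ β f ≤ criterion x t y lam₁ lam₂ β' f'

/-- `g` is a projection of the `j`-th covariate onto the RKHS: a minimizer over the RKHS of
`h ↦ 𝔼[(X⁽ʲ⁾ - h(T))²]`. -/
def IsProjection {𝒯 H : Type*} [MeasurableSpace 𝒯] [NormedAddCommGroup H]
    [InnerProductSpace ℝ H] [RKHS ℝ H 𝒯 ℝ] {p : ℕ} (ρ : Measure ((Fin p → ℝ) × 𝒯))
    (j : Fin p) (g : H) : Prop :=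
  ∀ h : H, ∫ z, (z.1 j - g z.2) ^ 2 ∂ρ ≤ ∫ z, (z.1 j - h z.2) ^ 2 ∂ρ

/-- The residual `X_T = X - (g₁(T), …, g_p(T))'`, as a function of `z = (X, T)`. -/
def residual {𝒯 H : Type*} [NormedAddCommGroup H] [InnerProductSpace ℝ H] [RKHS ℝ H 𝒯 ℝ]
    {p : ℕ} (g : Fin p → H) (z : (Fin p → ℝ) × 𝒯) : Fin p → ℝ :=
  fun j => z.1 j - g j z.2

/-- The matrix `𝔼[X_T X_T']`. -/
def residualCov {𝒯 H : Type*} [MeasurableSpace 𝒯] [NormedAddCommGroup H]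
    [InnerProductSpace ℝ H] [RKHS ℝ H 𝒯 ℝ] {p : ℕ} (ρ : Measure ((Fin p → ℝ) × 𝒯))
    (g : Fin p → H) : Matrix (Fin p) (Fin p) ℝ :=
  Matrix.of fun j k => ∫ z, residual g z j * residual g z k ∂ρ

/-- The population norm `‖X_T'v‖₂ = (𝔼[(X_T'v)²])^{1/2}` for a fixed vector `v`. -/
def residualNorm {𝒯 H : Type*} [MeasurableSpace 𝒯] [NormedAddCommGroup H]
    [InnerProductSpace ℝ H] [RKHS ℝ H 𝒯 ℝ] {p : ℕ} (ρ : Measure ((Fin p → ℝ) × 𝒯))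
    (g : Fin p → H) (v : Fin p → ℝ) : ℝ :=
  √(∫ z, (∑ j, residual g z j * v j) ^ 2 ∂ρ)

end PLM

end

/-! The estimator is compared with `(βstar, f + G)`, where `δ = β - βstar` and `G = ∑ j, δ j • g j`.
Moving by `s` along this segment changes the fitting residuals by `s` times `δ'X_T`, so the
first-order condition (`IsEstimator.first_order`) tests them against `δ'X_T`. The residuals split
into the noise, `f - fstar`, `∑ δ_k g_k(T)` and `δ'X_T` itself. The last yields the quadratic form
of `residualCov` up to sampling error; the others are empirical averages with mean zero, because
`X_T` is orthogonal in `L²` to every function of `H` (`IsProjection.integral_mul_eq_zero`).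

No chaining over a ball of `H` is needed: the average of `X_T⁽ʲ⁾ (f - fstar)(T)` is an inner product
of `f - fstar` with a random element of `H`, so Cauchy-Schwarz reduces uniformity in `f` to the norm
of a sum of i.i.d. centered vectors. That norm obeys a dimension-free Hoeffding bound
(`measure_pi_le_norm_sum_le_of_bounded`), obtained by following the expectation of `cosh ‖·‖` one
summand at a time.

Once the fluctuations are small, `lam₁` absorbs them (`IsEstimator.basic_inequality`). The
eigenvalue bounds then express both the support part of `δ` and `‖G‖` through `N = residualNorm ρ g
δ`, leaving a scalar quadratic inequality in `N` (`error_bounds`). -/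

noncomputable section

namespace PLM

/-! ### Dimension-free concentration through `cosh ‖·‖` -/

open Real in
/-- Convexity of `u ↦ cosh √u`, in the form of a bound on `cosh` of the third side of a triangle. -/
theorem cosh_le_of_sq_eq {a b t s : ℝ} (ht : |t| ≤ 1)
    (hs : s ^ 2 = a ^ 2 + b ^ 2 + 2 * a * b * t) :
    cosh s ≤ cosh a * cosh b + t * (sinh a * sinh b) := by
  obtain ⟨h1, h2⟩ := abs_le.1 ht
  -- `s ^ 2` is the convex combination of `(a + b) ^ 2` and `(a - b) ^ 2` with weights `(1 ± t) /
  -- 2`, and the series of `cosh` in powers of the square has nonnegative coefficients, so convexity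
  -- can be applied termwise.
  have hA := ((hasSum_cosh (a + b)).mul_left ((1 + t) / 2)).add
    ((hasSum_cosh (a - b)).mul_left ((1 - t) / 2))
  refine (hasSum_le (fun k => ?_) (hasSum_cosh s) hA).trans (le_of_eq ?_)
  · have hc := (convexOn_pow (𝕜 := ℝ) k).2
    specialize hc (Set.mem_Ici.2 (sq_nonneg (a + b))) (Set.mem_Ici.2 (sq_nonneg (a - b)))
      (by linarith : 0 ≤ (1 + t) / 2) (by linarith : 0 ≤ (1 - t) / 2) (by ring)
    have he : s ^ 2 = (1 + t) / 2 * (a + b) ^ 2 + (1 - t) / 2 * (a - b) ^ 2 := by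
      rw [hs]; ring
    simp only [smul_eq_mul] at hc
    rw [← he] at hc
    rw [pow_mul, pow_mul, pow_mul, ← mul_div_assoc, ← mul_div_assoc, ← add_div]
    gcongr
  · rw [cosh_add, cosh_sub]; ring

theorem exp_sub_self_le_exp_sq {b : ℝ} (hb : 0 ≤ b) : Real.exp b - b ≤ Real.exp (b ^ 2) := by
  rcases le_total b 1 with h | h
  · have h1 := Real.abs_exp_sub_one_sub_id_le (x := b) (by rwa [abs_of_nonneg hb])
    have h2 := Real.add_one_le_exp (b ^ 2)
    linarith [le_abs_self (Real.exp b - 1 - b)]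
  · have : Real.exp b ≤ Real.exp (b ^ 2) := Real.exp_le_exp.2 (by nlinarith)
    linarith

section Hilbert

variable {E : Type*} [NormedAddCommGroup E] [InnerProductSpace ℝ E]

/-- The last term is linear in `v`, hence vanishes on average for a centered `v`. It comes from
replacing `sinh ‖v‖` by `‖v‖` in the triangle bound; the error is at most `cosh ‖x‖ * (sinh ‖v‖ -
‖v‖)`, which leaves the factor `exp ‖v‖ - ‖v‖`. -/
theorem cosh_norm_add_le (x v : E) {b : ℝ} (hv : ‖v‖ ≤ b) :
    Real.cosh ‖x + v‖ ≤ Real.exp (b ^ 2) * Real.cosh ‖x‖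
      + Real.sinh ‖x‖ / ‖x‖ * inner ℝ x v := by
  have hexp : Real.exp ‖v‖ - ‖v‖ ≤ Real.exp (b ^ 2) :=
    (exp_sub_self_le_exp_sq (norm_nonneg v)).trans
      (Real.exp_le_exp.2 (pow_le_pow_left₀ (norm_nonneg v) hv 2))
  have hcx := Real.cosh_pos ‖x‖
  suffices h : Real.cosh ‖x + v‖ ≤ (Real.exp ‖v‖ - ‖v‖) * Real.cosh ‖x‖
      + Real.sinh ‖x‖ / ‖x‖ * inner ℝ x v by nlinarith
  rw [← Real.cosh_add_sinh ‖v‖]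
  have hsv : ‖v‖ ≤ Real.sinh ‖v‖ := Real.self_le_sinh_iff.2 (norm_nonneg v)
  rcases eq_or_ne x 0 with rfl | hx
  · simp only [zero_add, norm_zero, Real.cosh_zero, inner_zero_left, mul_zero, add_zero, mul_one]
    linarith
  rcases eq_or_ne v 0 with rfl | hv0
  · simp
  have hx' : 0 < ‖x‖ := norm_pos_iff.2 hx
  have hv' : 0 < ‖v‖ := norm_pos_iff.2 hv0
  have ht : |inner ℝ x v / (‖x‖ * ‖v‖)| ≤ 1 := abs_real_inner_div_norm_mul_norm_le_one x v
  set t := inner ℝ x v / (‖x‖ * ‖v‖) with htd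
  have hin : inner ℝ x v = t * (‖x‖ * ‖v‖) := by rw [htd]; field_simp
  have h := cosh_le_of_sq_eq (a := ‖x‖) (b := ‖v‖) (s := ‖x + v‖) ht (by
    rw [norm_add_sq_real, hin]; ring)
  refine h.trans ?_
  have hsc : Real.sinh ‖x‖ ≤ Real.cosh ‖x‖ := (Real.sinh_lt_cosh _).le
  have hs0 : 0 ≤ Real.sinh ‖x‖ := Real.sinh_nonneg_iff.2 hx'.le
  have h1 : Real.sinh ‖x‖ / ‖x‖ * inner ℝ x v = t * (Real.sinh ‖x‖ * ‖v‖) := by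
    rw [hin]; field_simp
  rw [h1]
  have h2 : t * (Real.sinh ‖x‖ * (Real.sinh ‖v‖ - ‖v‖))
      ≤ Real.cosh ‖x‖ * (Real.sinh ‖v‖ - ‖v‖) := by
    have h3 : t * Real.sinh ‖x‖ ≤ Real.cosh ‖x‖ := by
      nlinarith [(abs_le.1 ht).2]
    nlinarith
  nlinarith

variable {Z : Type*} [MeasurableSpace Z] (ν : Measure Z) [IsProbabilityMeasure ν]

theorem lintegral_cosh_norm_add_le {Φ : Z → E} {b : ℝ}
    (hm : ∀ x, Measurable fun z => inner ℝ x (Φ z)) (hb : ∀ᵐ z ∂ν, ‖Φ z‖ ≤ b)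
    (h0 : ∀ x, ∫ z, inner ℝ x (Φ z) ∂ν = 0) (x : E) :
    ∫⁻ z, ENNReal.ofReal (Real.cosh ‖x + Φ z‖) ∂ν
      ≤ ENNReal.ofReal (Real.exp (b ^ 2) * Real.cosh ‖x‖) := by
  have hi : Integrable (fun z => inner ℝ x (Φ z)) ν := by
    refine Integrable.of_bound (hm x).aestronglyMeasurable (‖x‖ * b) ?_
    filter_upwards [hb] with z hz
    exact (norm_inner_le_norm x (Φ z)).trans (by gcongr)
  have hI : Integrable (fun z => Real.exp (b ^ 2) * Real.cosh ‖x‖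
      + Real.sinh ‖x‖ / ‖x‖ * inner ℝ x (Φ z)) ν := (integrable_const _).add (hi.const_mul _)
  have hle : ∀ᵐ z ∂ν, Real.cosh ‖x + Φ z‖ ≤ Real.exp (b ^ 2) * Real.cosh ‖x‖
      + Real.sinh ‖x‖ / ‖x‖ * inner ℝ x (Φ z) := by
    filter_upwards [hb] with z hz using cosh_norm_add_le x (Φ z) hz
  calc _ ≤ ∫⁻ z, ENNReal.ofReal (Real.exp (b ^ 2) * Real.cosh ‖x‖
      + Real.sinh ‖x‖ / ‖x‖ * inner ℝ x (Φ z)) ∂ν := by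
        refine lintegral_mono_ae ?_
        filter_upwards [hle] with z hz using ENNReal.ofReal_le_ofReal hz
    _ = ENNReal.ofReal (∫ z, (Real.exp (b ^ 2) * Real.cosh ‖x‖
      + Real.sinh ‖x‖ / ‖x‖ * inner ℝ x (Φ z)) ∂ν) := by
        refine (ofReal_integral_eq_lintegral_ofReal hI ?_).symm
        filter_upwards [hle] with z hz using (Real.cosh_pos _).le.trans hz
    _ = _ := by
        rw [integral_add (integrable_const _) (hi.const_mul _), integral_const_mul
          (Real.sinh ‖x‖ / ‖x‖), h0]
        simp

/-- `E` carries no σ-algebra and need not be separable, so the squared norm is expanded into inner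
products, whose measurability is assumed. -/
theorem measurable_norm_add_sum {Φ : Z → E}
    (hm : ∀ x, Measurable fun z => inner ℝ x (Φ z))
    (hm2 : Measurable fun q : Z × Z => inner ℝ (Φ q.1) (Φ q.2)) (n : ℕ) (x : E) :
    Measurable fun z : Fin n → Z => ‖x + ∑ i, Φ (z i)‖ := by
  have h : (fun z : Fin n → Z => ‖x + ∑ i, Φ (z i)‖) = fun z =>
      √(inner ℝ x x + 2 * ∑ i, inner ℝ x (Φ (z i))
        + ∑ i, ∑ k, inner ℝ (Φ (z i)) (Φ (z k))) := by
    funext z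
    rw [← Real.sqrt_sq (norm_nonneg (x + ∑ i, Φ (z i))), norm_add_sq_real,
      ← real_inner_self_eq_norm_sq, ← real_inner_self_eq_norm_sq, inner_sum, sum_inner]
    simp_rw [inner_sum]
  rw [h]
  refine Measurable.sqrt (((measurable_const).add (measurable_const.mul
    (Finset.measurable_sum _ fun i _ => (hm x).comp (measurable_pi_apply i)))).add
    (Finset.measurable_sum _ fun i _ => Finset.measurable_sum _ fun k _ => ?_))
  have h2 : Measurable fun z : Fin n → Z => (z i, z k) := by fun_prop
  exact hm2.comp h2

/-- Integrating out all but the first coordinate reduces to `n` summands with starting point `x + Φ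
z`; this is why `x` is arbitrary. The one-step factor `M` is left abstract to cover both bounded
vectors and Gaussian multiples. -/
theorem lintegral_pi_cosh_norm_add_sum_le {Φ : Z → E} {M : ℝ} (hM : 0 ≤ M)
    (hm : ∀ x, Measurable fun z => inner ℝ x (Φ z))
    (hm2 : Measurable fun q : Z × Z => inner ℝ (Φ q.1) (Φ q.2))
    (hstep : ∀ x, ∫⁻ z, ENNReal.ofReal (Real.cosh ‖x + Φ z‖) ∂ν
      ≤ ENNReal.ofReal (M * Real.cosh ‖x‖)) (n : ℕ) (x : E) :
    ∫⁻ z, ENNReal.ofReal (Real.cosh ‖x + ∑ i, Φ (z i)‖) ∂(Measure.pi fun _ : Fin n => ν)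
      ≤ ENNReal.ofReal (M ^ n * Real.cosh ‖x‖) := by
  induction n generalizing x with
  | zero => simp
  | succ n ih =>
    have hmp := measurePreserving_piFinSuccAbove (fun _ : Fin (n + 1) => ν) 0
    let F : Z × (Fin n → Z) → ENNReal :=
      fun q => ENNReal.ofReal (Real.cosh ‖x + Φ q.1 + ∑ i, Φ (q.2 i)‖)
    have hFm : Measurable F := by
      have h1 := (measurable_norm_add_sum hm hm2 (n + 1) x).comp
        (MeasurableEquiv.piFinSuccAbove (fun _ : Fin (n + 1) => Z) 0).symm.measurable
      have h2 : F = fun q => ENNReal.ofReal (Real.cosh (((fun z : Fin (n + 1) → Z =>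
          ‖x + ∑ i, Φ (z i)‖) ∘
          (MeasurableEquiv.piFinSuccAbove (fun _ : Fin (n + 1) => Z) 0).symm) q)) := by
        funext q
        simp [F, Fin.sum_univ_succ, add_assoc, MeasurableEquiv.piFinSuccAbove]
      rw [h2]
      exact (Real.measurable_cosh.comp h1).ennreal_ofReal
    have hF : ∀ z : Fin (n + 1) → Z, ENNReal.ofReal (Real.cosh ‖x + ∑ i, Φ (z i)‖)
        = F (MeasurableEquiv.piFinSuccAbove (fun _ => Z) 0 z) := by
      intro z
      simp [F, Fin.sum_univ_succ, add_assoc, MeasurableEquiv.piFinSuccAbove, Fin.tail]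
    simp_rw [hF]
    rw [hmp.lintegral_comp hFm, lintegral_prod _ hFm.aemeasurable]
    calc _ ≤ ∫⁻ z, ENNReal.ofReal (M ^ n) * ENNReal.ofReal (Real.cosh ‖x + Φ z‖) ∂ν := by
          refine lintegral_mono fun z => ?_
          rw [← ENNReal.ofReal_mul (by positivity)]
          exact ih (x + Φ z)
      _ ≤ ENNReal.ofReal (M ^ n) * ENNReal.ofReal (M * Real.cosh ‖x‖) := by
          rw [lintegral_const_mul' _ _ ENNReal.ofReal_ne_top]
          gcongr
          exact hstep x
      _ = _ := by
          rw [← ENNReal.ofReal_mul (by positivity)]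
          ring_nf

/-- Markov's inequality for `cosh` of the norm of a sum of i.i.d. vectors. -/
theorem measure_pi_le_norm_sum_le {Φ : Z → E} {M u : ℝ} (hM : 0 ≤ M)
    (hm : ∀ x, Measurable fun z => inner ℝ x (Φ z))
    (hm2 : Measurable fun q : Z × Z => inner ℝ (Φ q.1) (Φ q.2))
    (hstep : ∀ x, ∫⁻ z, ENNReal.ofReal (Real.cosh ‖x + Φ z‖) ∂ν
      ≤ ENNReal.ofReal (M * Real.cosh ‖x‖)) (n : ℕ) :
    (Measure.pi fun _ : Fin n => ν).real {z | u ≤ ‖∑ i, Φ (z i)‖}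
      ≤ 2 * (M ^ n * Real.exp (-u)) := by
  have h1 := lintegral_pi_cosh_norm_add_sum_le ν hM hm hm2 hstep n 0
  have h2 := mul_meas_ge_le_lintegral (μ := Measure.pi fun _ : Fin n => ν)
    (Real.measurable_cosh.comp (measurable_norm_add_sum hm hm2 n 0)).ennreal_ofReal
    (ENNReal.ofReal (Real.exp u / 2))
  have h3 := h2.trans h1
  have hsub : {z : Fin n → Z | u ≤ ‖∑ i, Φ (z i)‖} ⊆ {z | ENNReal.ofReal (Real.exp u / 2) ≤
      ENNReal.ofReal ((Real.cosh ∘ fun z : Fin n → Z => ‖0 + ∑ i, Φ (z i)‖) z)} := by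
    intro z hz
    refine ENNReal.ofReal_le_ofReal ?_
    simp only [Function.comp, zero_add, Real.cosh_eq]
    have := Real.exp_le_exp.2 hz
    have := Real.exp_pos (-‖∑ i, Φ (z i)‖)
    linarith
  have h4 := (mul_le_mul_right (measure_mono hsub) (ENNReal.ofReal (Real.exp u / 2))).trans h3
  rw [← ofReal_measureReal, ← ENNReal.ofReal_mul (by positivity)] at h4
  have h5 := (ENNReal.ofReal_le_ofReal_iff (by positivity)).1 h4
  simp only [norm_zero, Real.cosh_zero, mul_one] at h5
  rw [Real.exp_neg]
  have hu := Real.exp_pos u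
  rw [← div_eq_mul_inv, ← mul_div_assoc, le_div_iff₀ hu]
  linarith

/-- A dimension-free Hoeffding inequality for i.i.d. centered bounded vectors of an inner product
space. -/
theorem measure_pi_le_norm_sum_le_of_bounded {Φ : Z → E} {b u : ℝ} (hb0 : 0 < b) (hu : 0 ≤ u)
    (hm : ∀ x, Measurable fun z => inner ℝ x (Φ z))
    (hm2 : Measurable fun q : Z × Z => inner ℝ (Φ q.1) (Φ q.2))
    (hb : ∀ᵐ z ∂ν, ‖Φ z‖ ≤ b) (h0 : ∀ x, ∫ z, inner ℝ x (Φ z) ∂ν = 0) {n : ℕ} (hn : 0 < n) :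
    (Measure.pi fun _ : Fin n => ν).real {z | n * u ≤ ‖∑ i, Φ (z i)‖}
      ≤ 2 * Real.exp (-(n * u ^ 2 / (4 * b ^ 2))) := by
  rcases hu.eq_or_lt with rfl | hu
  · simp
  -- This scale minimizes the exponent `n * (l * b) ^ 2 - l * (n * u)`.
  set l : ℝ := u / (2 * b ^ 2) with hl
  have hl0 : 0 < l := by positivity
  have hbl : ∀ᵐ z ∂ν, ‖l • Φ z‖ ≤ l * b := by
    filter_upwards [hb] with z hz
    rw [norm_smul, Real.norm_of_nonneg hl0.le]
    gcongr
  have key := measure_pi_le_norm_sum_le ν (Φ := fun z => l • Φ z) (u := l * (n * u))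
    (Real.exp_pos ((l * b) ^ 2)).le
    (fun x => by simpa [inner_smul_right] using (hm x).const_mul l)
    (by simpa [inner_smul_right, inner_smul_left] using (hm2.const_mul l).const_mul l)
    (lintegral_cosh_norm_add_le ν (fun x => by simpa [inner_smul_right] using (hm x).const_mul l)
      hbl (fun x => by simp [inner_smul_right, integral_const_mul, h0])) n
  have hset : {z : Fin n → Z | l * (n * u) ≤ ‖∑ i, l • Φ (z i)‖}
      = {z | n * u ≤ ‖∑ i, Φ (z i)‖} := by
    ext z
    simp only [Set.mem_ofPred_eq]
    rw [← Finset.smul_sum, norm_smul, Real.norm_of_nonneg hl0.le, mul_le_mul_iff_right₀ hl0]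
  rw [hset] at key
  refine key.trans (le_of_eq ?_)
  rw [← Real.exp_nat_mul, ← Real.exp_add]
  congr 2
  rw [hl]
  field_simp
  ring

end Hilbert

/-! ### Gaussian multipliers, scalar Hoeffding and the union bound -/

/-- A tail bound for the correlation of bounded i.i.d. weights with independent standard normal
noise. -/
theorem measure_pi_le_abs_sum_gaussian_le {Z : Type*} [MeasurableSpace Z] (ν : Measure Z)
    [IsProbabilityMeasure ν] {w : Z → ℝ} {b u : ℝ} (hb0 : 0 < b) (hu : 0 ≤ u)
    (hm : Measurable w) (hb : ∀ᵐ z ∂ν, |w z| ≤ b) {n : ℕ} :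
    (Measure.pi fun _ : Fin n => ν.prod (gaussianReal 0 1)).real
        {z | n * u ≤ |∑ i, w (z i).1 * (z i).2|}
      ≤ 2 * Real.exp (-(n * u ^ 2 / (2 * b ^ 2))) := by
  rcases hu.eq_or_lt with rfl | hu
  · simp
  -- This scale minimizes `n * (l * b) ^ 2 / 2 - l * (n * u)`; the factor `1 / 2` is that of the
  -- Gaussian moment generating function.
  set l : ℝ := u / b ^ 2 with hl
  have hl0 : 0 < l := by positivity
  have hwm : Measurable fun q : Z × ℝ => l * (w q.1 * q.2) :=
    ((hm.comp measurable_fst).mul measurable_snd).const_mul l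
  have hg : ∀ x s : ℝ, ∫⁻ e, ENNReal.ofReal (Real.cosh (x + s * e)) ∂(gaussianReal 0 1)
      = ENNReal.ofReal (Real.exp (s ^ 2 / 2) * Real.cosh x) := by
    intro x s
    have hE : ∀ s : ℝ, ∫ e, Real.exp (s * e) ∂(gaussianReal 0 1) = Real.exp (s ^ 2 / 2) := by
      intro s
      have := congrFun (mgf_fun_id_gaussianReal (μ := 0) (v := 1)) s
      simpa [mgf] using this
    have hI : ∀ s : ℝ, Integrable (fun e => Real.exp (s * e)) (gaussianReal 0 1) :=
      fun s => integrable_exp_mul_gaussianReal s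
    have he : (fun e => Real.cosh (x + s * e)) = fun e =>
        Real.exp x / 2 * Real.exp (s * e) + Real.exp (-x) / 2 * Real.exp (-s * e) := by
      funext e
      rw [Real.cosh_eq, neg_add, Real.exp_add, Real.exp_add]
      ring_nf
    have hI' : Integrable (fun e => Real.cosh (x + s * e)) (gaussianReal 0 1) := by
      rw [he]
      exact ((hI s).const_mul _).add ((hI (-s)).const_mul _)
    rw [← ofReal_integral_eq_lintegral_ofReal hI' (.of_forall fun e => (Real.cosh_pos _).le), he,
      integral_add ((hI s).const_mul _) ((hI (-s)).const_mul _), integral_const_mul,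
      integral_const_mul, hE, hE, Real.cosh_eq]
    ring_nf
  have key := measure_pi_le_norm_sum_le (ν.prod (gaussianReal 0 1))
    (Φ := fun q : Z × ℝ => l * (w q.1 * q.2)) (u := l * (n * u))
    (M := Real.exp ((l * b) ^ 2 / 2)) (Real.exp_pos _).le
    (fun x => by simpa [mul_comm] using hwm.const_mul x)
    (by simpa [Function.comp_def, Pi.mul_def] using
      (hwm.comp measurable_snd).mul (hwm.comp measurable_fst))
    (fun x => by
      have hmeas : Measurable fun q : Z × ℝ =>
          ENNReal.ofReal (Real.cosh (x + l * (w q.1 * q.2))) :=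
        (Real.measurable_cosh.comp (hwm.const_add x)).ennreal_ofReal
      simp only [Real.norm_eq_abs, Real.cosh_abs]
      rw [lintegral_prod _ hmeas.aemeasurable]
      calc _ ≤ ∫⁻ _ : Z, ENNReal.ofReal (Real.exp ((l * b) ^ 2 / 2) * Real.cosh x) ∂ν := by
            refine lintegral_mono_ae ?_
            filter_upwards [hb] with z hz
            have := hg x (l * w z)
            simp only [mul_assoc] at this ⊢
            rw [this]
            refine ENNReal.ofReal_le_ofReal ?_
            have hcx := (Real.cosh_pos x).le
            have hsq : (l * w z) ^ 2 ≤ (l * b) ^ 2 := by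
              rw [mul_pow, mul_pow]
              have : w z ^ 2 ≤ b ^ 2 := by
                rw [← sq_abs]; gcongr
              gcongr
            gcongr
        _ = _ := by simp) n
  have hset : {z : Fin n → Z × ℝ | l * (n * u) ≤ ‖∑ i, l * (w (z i).1 * (z i).2)‖}
      = {z | n * u ≤ |∑ i, w (z i).1 * (z i).2|} := by
    ext z
    simp only [Set.mem_ofPred_eq]
    rw [← Finset.mul_sum, norm_mul, Real.norm_of_nonneg hl0.le, mul_le_mul_iff_right₀ hl0,
      Real.norm_eq_abs]
  rw [hset] at key
  refine key.trans (le_of_eq ?_)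
  rw [← Real.exp_nat_mul, ← Real.exp_add]
  congr 2
  rw [hl]
  field_simp
  ring

theorem measurableSet_le_abs_sum {Z : Type*} {n : ℕ} [MeasurableSpace Z] {φ : Z → ℝ} (hφ : Measurable φ)
    (u : ℝ) : MeasurableSet {z : Fin n → Z | u ≤ |∑ i, φ (z i)|} :=
  measurableSet_le measurable_const (Finset.measurable_sum _ fun i _ =>
    hφ.comp (measurable_pi_apply i)).norm

theorem measurable_uncurry_comp {Z 𝒯 : Type*} [MeasurableSpace Z] [MeasurableSpace 𝒯]
    {τ : Z → 𝒯} {F : 𝒯 → 𝒯 → ℝ}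
    (hτ : Measurable τ) (hF : Measurable fun st : 𝒯 × 𝒯 => F st.1 st.2) :
    Measurable fun q : Z × Z => F (τ q.1) (τ q.2) :=
  hF.comp ((hτ.comp measurable_fst).prodMk (hτ.comp measurable_snd))

theorem measure_pi_le_abs_sum_le {Z : Type*} [MeasurableSpace Z] (ν : Measure Z)
    [IsProbabilityMeasure ν] {φ : Z → ℝ} {b u : ℝ} (hb0 : 0 < b) (hu : 0 ≤ u)
    (hm : Measurable φ) (hb : ∀ᵐ z ∂ν, |φ z| ≤ b) (h0 : ∫ z, φ z ∂ν = 0) {n : ℕ} (hn : 0 < n) :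
    (Measure.pi fun _ : Fin n => ν).real {z | n * u ≤ |∑ i, φ (z i)|}
      ≤ 2 * Real.exp (-(n * u ^ 2 / (4 * b ^ 2))) := by
  refine measure_pi_le_norm_sum_le_of_bounded ν (Φ := φ) hb0 hu (fun x => ?_) ?_ hb
    (fun x => ?_) hn
  · simpa using hm.mul_const x
  · simpa [Function.comp_def, Pi.mul_def] using
      (hm.comp measurable_snd).mul (hm.comp measurable_fst)
  · simp [integral_mul_const, h0]

theorem measureReal_iUnion_le_card_mul {Ω ι : Type*} [MeasurableSpace Ω] [Fintype ι]
    {μ : Measure Ω} {s : ι → Set Ω} {b : ℝ} (h : ∀ i, μ.real (s i) ≤ b) :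
    μ.real (⋃ i, s i) ≤ Fintype.card ι * b := by
  refine (measureReal_iUnion_fintype_le _).trans ?_
  refine (Finset.sum_le_card_nsmul _ _ _ fun i _ => h i).trans (le_of_eq ?_)
  simp

/-! ### Quadratic forms and extreme eigenvalues -/

section Spectrum

variable {p : ℕ} {A : Matrix (Fin p) (Fin p) ℝ}

/-- Subtracting `m` times the identity shifts the spectrum into the nonnegative reals, so the
difference is positive semidefinite. -/
theorem le_quadraticForm_of_le_spectrum (hA : A.IsHermitian) {m : ℝ}
    (hm : ∀ x ∈ spectrum ℝ A, m ≤ x) (v : Fin p → ℝ) :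
    m * ∑ j, v j ^ 2 ≤ ∑ j, ∑ k, v j * v k * A j k := by
  have hP : (A - algebraMap ℝ _ m).PosSemidef := by
    rw [Matrix.posSemidef_iff_isHermitian_and_spectrum_nonneg]
    refine ⟨hA.sub ?_, ?_⟩
    · rw [Matrix.algebraMap_eq_diagonal]
      exact Matrix.isHermitian_diagonal _
    · rw [← spectrum.sub_singleton_eq]
      rintro _ ⟨x, hx, _, rfl, rfl⟩
      simpa using hm x hx
  have h := hP.dotProduct_mulVec_nonneg v
  simp only [Matrix.sub_mulVec, dotProduct_sub, Algebra.algebraMap_eq_smul_one,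
    Matrix.smul_mulVec, Matrix.one_mulVec, dotProduct_smul, star_trivial] at h
  simp only [dotProduct, Matrix.mulVec, Finset.mul_sum, smul_eq_mul] at h
  have e1 : ∀ j k, v j * (A j k * v k) = v j * v k * A j k := fun j k => by ring
  simp only [e1] at h
  simp only [Finset.mul_sum, sq]
  linarith

theorem quadraticForm_le_of_spectrum_le (hA : A.IsHermitian) {m : ℝ}
    (hm : ∀ x ∈ spectrum ℝ A, x ≤ m) (v : Fin p → ℝ) :
    ∑ j, ∑ k, v j * v k * A j k ≤ m * ∑ j, v j ^ 2 := by
  have h := le_quadraticForm_of_le_spectrum hA.neg (m := -m) (fun x hx => by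
    rw [← spectrum.neg_eq] at hx
    have := hm _ hx
    linarith) v
  simp only [Matrix.neg_apply, mul_neg, Finset.sum_neg_distrib, neg_mul] at h
  linarith

end Spectrum

/-! ### `ℓ₁` inequalities and sparsity -/

section Sums

variable {p : ℕ}

theorem l1Norm_nonneg (v : Fin p → ℝ) : 0 ≤ l1Norm v :=
  Finset.sum_nonneg fun _ _ => abs_nonneg _

theorem abs_sum_mul_le_l1Norm (v a : Fin p → ℝ) {B : ℝ} (h : ∀ j, |a j| ≤ B) :
    |∑ j, v j * a j| ≤ l1Norm v * B := by
  rw [l1Norm, Finset.sum_mul]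
  refine (Finset.abs_sum_le_sum_abs _ _).trans (Finset.sum_le_sum fun j _ => ?_)
  rw [abs_mul]
  exact mul_le_mul_of_nonneg_left (h j) (abs_nonneg _)

theorem abs_sum_sum_mul_le_l1Norm_sq (v : Fin p → ℝ) (a : Fin p → Fin p → ℝ) {B : ℝ}
    (h : ∀ j k, |a j k| ≤ B) : |∑ j, ∑ k, v j * v k * a j k| ≤ l1Norm v ^ 2 * B := by
  have e : ∑ j, ∑ k, v j * v k * a j k = ∑ j, v j * ∑ k, v k * a j k := by
    simp_rw [Finset.mul_sum, mul_assoc]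
  rw [e, sq, mul_assoc]
  exact abs_sum_mul_le_l1Norm v _ fun j => abs_sum_mul_le_l1Norm v _ (h j)

/-- The `ℓ₁`-norm changes by at least the full `ℓ₁`-distance minus twice its part on the support. -/
theorem l1Norm_sub_le (β b : Fin p → ℝ) :
    l1Norm (β - b) - 2 * ∑ j with b j ≠ 0, |(β - b) j| ≤ l1Norm β - l1Norm b := by
  unfold l1Norm
  rw [Finset.sum_filter, Finset.mul_sum, ← Finset.sum_sub_distrib, ← Finset.sum_sub_distrib]
  refine Finset.sum_le_sum fun j _ => ?_
  by_cases h : b j = 0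
  · simp [h]
  · simp only [ne_eq, h, not_false_eq_true, if_true, Pi.sub_apply]
    have := abs_sub_abs_le_abs_sub (b j) (β j)
    rw [abs_sub_comm] at this
    linarith

theorem sum_abs_support_le (b v : Fin p → ℝ) :
    ∑ j with b j ≠ 0, |v j| ≤ √(sparsity b) * √(∑ j, v j ^ 2) := by
  rw [← Real.sqrt_mul (Nat.cast_nonneg _)]
  refine Real.le_sqrt_of_sq_le ?_
  have h1 := sq_sum_le_card_mul_sum_sq (s := Finset.univ.filter fun j => b j ≠ 0)
    (f := fun j => |v j|)
  have hc : ((Finset.univ.filter fun j => b j ≠ 0).card : ℝ) = sparsity b := by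
    rw [sparsity, Set.ncard_eq_toFinset_card']
    congr 2
    ext j
    simp
  rw [hc] at h1
  refine h1.trans ?_
  simp only [sq_abs]
  gcongr
  exact Finset.filter_subset _ _

end Sums

/-! ### Evaluation, measurability and orthogonality in the RKHS -/

section RKHS

variable {𝒯 H : Type*} [NormedAddCommGroup H] [InnerProductSpace ℝ H] [CompleteSpace H]
  [RKHS ℝ H 𝒯 ℝ]

/-- The representer in `H` of the evaluation at `t`. -/
def representer (H : Type*) [NormedAddCommGroup H] [InnerProductSpace ℝ H] [CompleteSpace H]
    [RKHS ℝ H 𝒯 ℝ] (t : 𝒯) : H := RKHS.kerFun H t 1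

theorem inner_representer (f : H) (t : 𝒯) : inner ℝ f (representer H t) = f t := by
  simp [representer]

theorem inner_representer_representer (s t : 𝒯) :
    inner ℝ (representer H s) (representer H t) = kernel H s t := by
  rw [real_inner_comm, kernel]
  have := RKHS.kernel_inner H s t 1 1
  simp only [representer]
  rw [← this]
  simp

theorem norm_representer_le (hK : ∀ t : 𝒯, kernel H t t ≤ 1) (t : 𝒯) :
    ‖representer H t‖ ≤ 1 := by
  have h := hK t
  rw [← inner_representer_representer, real_inner_self_eq_norm_sq] at h
  exact (sq_le_one_iff₀ (norm_nonneg _)).1 h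

theorem abs_apply_le (hK : ∀ t : 𝒯, kernel H t t ≤ 1) (f : H) (t : 𝒯) : |f t| ≤ ‖f‖ := by
  rw [← inner_representer]
  refine (abs_real_inner_le_norm _ _).trans ?_
  exact mul_le_of_le_one_right (norm_nonneg _) (norm_representer_le hK t)

variable [MeasurableSpace 𝒯]

/-- Kernel sections are measurable and span a dense subspace; norm limits in `H` are pointwise
limits because evaluations are continuous. -/
theorem measurable_apply (hKm : Measurable fun st : 𝒯 × 𝒯 => kernel H st.1 st.2) (f : H) :
    Measurable (f : 𝒯 → ℝ) := by
  have hspan : ∀ g ∈ Submodule.span ℝ {RKHS.kerFun H x v | (x : 𝒯) (v : ℝ)},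
      Measurable (g : 𝒯 → ℝ) := by
    intro g hg
    induction hg using Submodule.span_induction with
    | mem g hg =>
      obtain ⟨x, v, rfl⟩ := hg
      have h : (RKHS.kerFun H x v : 𝒯 → ℝ) = fun t => v * kernel H t x := by
        funext t
        have : RKHS.kerFun H x v = v • RKHS.kerFun H x (1 : ℝ) := by
          rw [← map_smul]; simp
        rw [this, RKHS.coe_smul, Pi.smul_apply, RKHS.kerFun_apply, smul_eq_mul, kernel]
      rw [h]
      exact (hKm.comp (measurable_id.prodMk measurable_const)).const_mul v
    | zero => rw [RKHS.coe_zero]; exact measurable_const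
    | add g₁ g₂ _ _ h₁ h₂ => rw [RKHS.coe_add]; exact h₁.add h₂
    | smul a g _ h => rw [RKHS.coe_smul]; exact h.const_smul a
  have hf : f ∈ closure (Submodule.span ℝ {RKHS.kerFun H x v | (x : 𝒯) (v : ℝ)} : Set H) := by
    rw [← Submodule.topologicalClosure_coe, RKHS.kerFun_dense]
    trivial
  obtain ⟨u, hu, hlim⟩ := mem_closure_iff_seq_limit.1 hf
  refine measurable_of_tendsto_metrizable (fun n => hspan _ (hu n)) ?_
  rw [tendsto_pi_nhds]
  exact fun t => ((RKHS.continuous_eval t).tendsto f).comp hlim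

variable {p : ℕ} {ρ : Measure ((Fin p → ℝ) × 𝒯)}

theorem measurable_residual (hKm : Measurable fun st : 𝒯 × 𝒯 => kernel H st.1 st.2)
    (g : Fin p → H) (j : Fin p) : Measurable fun z : (Fin p → ℝ) × 𝒯 => residual g z j :=
  ((measurable_pi_apply j).comp measurable_fst).sub
    ((measurable_apply hKm (g j)).comp measurable_snd)

/-- The residual of the projection is orthogonal to the RKHS. -/
theorem IsProjection.integral_mul_eq_zero [IsProbabilityMeasure ρ]
    (hKm : Measurable fun st : 𝒯 × 𝒯 => kernel H st.1 st.2)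
    (hK : ∀ t : 𝒯, kernel H t t ≤ 1) {g : Fin p → H} {j : Fin p} {C : ℝ}
    (hR : ∀ᵐ z ∂ρ, |residual g z j| ≤ C) (hg : IsProjection ρ j (g j)) (h : H) :
    ∫ z, residual g z j * h z.2 ∂ρ = 0 := by
  have hRm := measurable_residual hKm g j
  have hhm : Measurable fun z : (Fin p → ℝ) × 𝒯 => h z.2 :=
    (measurable_apply hKm h).comp measurable_snd
  have hI1 : Integrable (fun z => residual g z j ^ 2) ρ := by
    refine Integrable.of_bound (hRm.pow_const 2).aestronglyMeasurable (C ^ 2) ?_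
    filter_upwards [hR] with z hz
    rw [Real.norm_eq_abs, abs_pow]
    gcongr
  have hI2 : Integrable (fun z => residual g z j * h z.2) ρ := by
    refine Integrable.of_bound (hRm.mul hhm).aestronglyMeasurable (C * ‖h‖) ?_
    filter_upwards [hR] with z hz
    rw [Real.norm_eq_abs, abs_mul]
    exact mul_le_mul hz (abs_apply_le hK h _) (abs_nonneg _) ((abs_nonneg _).trans hz)
  have hI3 : Integrable (fun z : (Fin p → ℝ) × 𝒯 => h z.2 ^ 2) ρ := by
    refine Integrable.of_bound (hhm.pow_const 2).aestronglyMeasurable (‖h‖ ^ 2) ?_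
    refine .of_forall fun z => ?_
    rw [Real.norm_eq_abs, abs_pow]
    gcongr
    exact abs_apply_le hK h _
  -- Perturbing `g j` by `s • h` changes the squared error by a quadratic in `s` without constant
  -- term. Being nonnegative, it has discriminant at most `0`, and that discriminant is the square
  -- of the linear coefficient.
  have key : ∀ s : ℝ, 0 ≤ (∫ z, h z.2 ^ 2 ∂ρ) * (s * s)
      + (-2 * ∫ z, residual g z j * h z.2 ∂ρ) * s + 0 := by
    intro s
    have h1 := hg (g j + s • h)
    have e1 : ∫ z, (z.1 j - (g j + s • h) z.2) ^ 2 ∂ρ = ∫ z, residual g z j ^ 2 ∂ρ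
        + ((-2 * s) * ∫ z, residual g z j * h z.2 ∂ρ) + s ^ 2 * ∫ z, h z.2 ^ 2 ∂ρ := by
      have hI12 : Integrable (fun z => residual g z j ^ 2
          + -2 * s * (residual g z j * h z.2)) ρ := hI1.add (hI2.const_mul _)
      rw [← integral_const_mul, ← integral_const_mul, ← integral_add hI1 (hI2.const_mul _),
        ← integral_add hI12 (hI3.const_mul _)]
      refine integral_congr_ae (.of_forall fun z => ?_)
      simp only [residual, RKHS.coe_add, RKHS.coe_smul, Pi.add_apply, Pi.smul_apply, smul_eq_mul]
      ring
    rw [e1] at h1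
    simp only [residual] at h1 ⊢
    linarith
  have hd := discrim_le_zero key
  simp only [discrim] at hd
  nlinarith [sq_nonneg (∫ z, residual g z j * h z.2 ∂ρ)]

omit [CompleteSpace H] in
theorem residualCov_isHermitian (g : Fin p → H) : (residualCov ρ g).IsHermitian := by
  ext j k
  simp [residualCov, mul_comm]

theorem integrable_residual_mul_residual [IsFiniteMeasure ρ]
    (hKm : Measurable fun st : 𝒯 × 𝒯 => kernel H st.1 st.2) {g : Fin p → H} {C : ℝ}
    (hR : ∀ j, ∀ᵐ z ∂ρ, |residual g z j| ≤ C) (j k : Fin p) :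
    Integrable (fun z => residual g z j * residual g z k) ρ := by
  refine Integrable.of_bound ((measurable_residual hKm g j).mul
    (measurable_residual hKm g k)).aestronglyMeasurable (C * C) ?_
  filter_upwards [hR j, hR k] with z h1 h2
  rw [Real.norm_eq_abs, abs_mul]
  exact mul_le_mul h1 h2 (abs_nonneg _) ((abs_nonneg _).trans h1)

theorem residualNorm_sq [IsFiniteMeasure ρ]
    (hKm : Measurable fun st : 𝒯 × 𝒯 => kernel H st.1 st.2) {g : Fin p → H} {C : ℝ}
    (hR : ∀ j, ∀ᵐ z ∂ρ, |residual g z j| ≤ C) (v : Fin p → ℝ) :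
    residualNorm ρ g v ^ 2 = ∑ j, ∑ k, v j * v k * residualCov ρ g j k := by
  have hI := integrable_residual_mul_residual (ρ := ρ) hKm hR
  rw [residualNorm, Real.sq_sqrt (integral_nonneg fun z => sq_nonneg _)]
  simp only [residualCov, Matrix.of_apply, ← integral_const_mul]
  simp_rw [← integral_finsetSum Finset.univ fun k _ => (hI _ k).const_mul _]
  rw [← integral_finsetSum Finset.univ fun j _ =>
    integrable_finsetSum Finset.univ fun k _ => (hI j k).const_mul _]
  refine integral_congr_ae (.of_forall fun z => ?_)
  simp only [sq, Finset.sum_mul_sum]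
  exact Finset.sum_congr rfl fun j _ => Finset.sum_congr rfl fun k _ => by ring

end RKHS

/-- Divide by `s` and let `s` tend to `0`: this turns minimality along a segment into a first-order
condition without differentiating the `ℓ₁` penalty. -/
theorem nonneg_of_forall_quadratic {A C : ℝ}
    (h : ∀ s : ℝ, 0 < s → s ≤ 1 → 0 ≤ s * A + s ^ 2 * C) : 0 ≤ A := by
  by_contra! hA
  have hC : 0 < |C| + 1 := by positivity
  have hs : 0 < min 1 (-A / (2 * (|C| + 1))) := lt_min one_pos (div_pos (by linarith) (by linarith))
  have h1 := h _ hs (min_le_left _ _)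
  set s := min 1 (-A / (2 * (|C| + 1)))
  have h2 : s * (2 * (|C| + 1)) ≤ -A := by
    rw [← le_div_iff₀ (by linarith)]
    exact min_le_right _ _
  have h3 : s * C ≤ s * (|C| + 1) := by
    gcongr
    linarith [le_abs_self C]
  have h4 : 0 ≤ A + s * C := by
    by_contra! hneg
    nlinarith
  linarith

/-! ### Optimality condition and basic inequality -/

section Deterministic

variable {𝒯 H : Type*} [NormedAddCommGroup H] [InnerProductSpace ℝ H] [RKHS ℝ H 𝒯 ℝ] {n p : ℕ}

theorem sum_apply (c : Fin p → ℝ) (g : Fin p → H) (t : 𝒯) :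
    (∑ j, c j • g j : H) t = ∑ j, c j * g j t := by
  have h := map_sum (RKHS.coeCLM ℝ : H →L[ℝ] 𝒯 → ℝ) (fun j => c j • g j) Finset.univ
  simp only [RKHS.coeCLM_apply] at h
  rw [h]
  simp

/-- The first-order optimality condition of the estimator `(β, f)` along the segment towards
`(βstar, f + ∑ⱼ (β - βstar)ⱼ gⱼ)`. -/
theorem IsEstimator.first_order {x : Fin n → Fin p → ℝ} {t : Fin n → 𝒯} {y : Fin n → ℝ}
    {lam₁ lam₂ L : ℝ} (hl₁ : 0 ≤ lam₁) {βstar β : Fin p → ℝ} {f : H}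
    (hest : IsEstimator x t y lam₁ lam₂ βstar L β f) (g : Fin p → H) :
    0 ≤ 1 / (n : ℝ) * ∑ i, (y i - ∑ j, x i j * β j - f (t i))
          * (∑ j, (β - βstar) j * residual g (x i, t i) j)
        + lam₁ * (l1Norm βstar - l1Norm β)
        + lam₂ * inner ℝ f (∑ j, (β - βstar) j • g j) := by
  set G : H := ∑ j, (β - βstar) j • g j with hG
  set D : Fin n → ℝ := fun i => ∑ j, (β - βstar) j * residual g (x i, t i) j with hD
  set R : Fin n → ℝ := fun i => y i - ∑ j, x i j * β j - f (t i) with hRdef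
  refine nonneg_of_forall_quadratic
    (C := 1 / (2 * (n : ℝ)) * ∑ i, D i ^ 2 + lam₂ / 2 * ‖G‖ ^ 2) fun s hs0 hs1 => ?_
  have hb : ∀ v : Fin p → ℝ, l1Norm ((1 - s) • v) = (1 - s) * l1Norm v := fun v => by
    simp [l1Norm, abs_mul, abs_of_nonneg (sub_nonneg.2 hs1), Finset.mul_sum]
  have hfeas : l1Norm (β - s • (β - βstar) - βstar) ≤ L := by
    have e : β - s • (β - βstar) - βstar = (1 - s) • (β - βstar) := by module
    rw [e, hb]
    have := l1Norm_nonneg (β - βstar)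
    nlinarith [hest.1]
  have hopt := hest.2 (β - s • (β - βstar)) (f + s • G) hfeas
  have hl1 : l1Norm (β - s • (β - βstar)) ≤ (1 - s) * l1Norm β + s * l1Norm βstar := by
    simp only [l1Norm, Finset.mul_sum, ← Finset.sum_add_distrib]
    refine Finset.sum_le_sum fun j _ => ?_
    have e : (β - s • (β - βstar)) j = (1 - s) * β j + s * βstar j := by
      simp only [Pi.sub_apply, Pi.smul_apply, smul_eq_mul]; ring
    rw [e]
    refine (abs_add_le _ _).trans (le_of_eq ?_)
    rw [abs_mul, abs_mul, abs_of_nonneg (sub_nonneg.2 hs1), abs_of_nonneg hs0.le]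
  -- The shift `s • G` of `f` cancels the part of `X'δ` explained by the projections, so only
  -- `δ'X_T` remains.
  have hres : ∀ i, y i - ∑ j, x i j * (β - s • (β - βstar)) j - (f + s • G) (t i)
      = R i + s * D i := by
    intro i
    simp only [hRdef, hD, hG, residual, RKHS.coe_add, RKHS.coe_smul, Pi.add_apply, Pi.smul_apply,
      sum_apply, smul_eq_mul, Pi.sub_apply, Finset.mul_sum]
    have e : ∀ j, x i j * (β j - s * (β j - βstar j)) = x i j * β j
        - s * ((β j - βstar j) * (x i j - g j (t i))) - s * ((β j - βstar j) * g j (t i)) :=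
      fun j => by ring
    simp only [e, Finset.sum_sub_distrib]
    ring
  have hsq : ∑ i, (R i + s * D i) ^ 2
      = ∑ i, R i ^ 2 + 2 * s * ∑ i, R i * D i + s ^ 2 * ∑ i, D i ^ 2 := by
    simp only [Finset.mul_sum, ← Finset.sum_add_distrib]
    exact Finset.sum_congr rfl fun i _ => by ring
  have hn2 : ‖f + s • G‖ ^ 2 = ‖f‖ ^ 2 + 2 * s * inner ℝ f G + s ^ 2 * ‖G‖ ^ 2 := by
    rw [norm_add_sq_real, inner_smul_right, norm_smul, mul_pow, Real.norm_eq_abs, sq_abs]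
    ring
  simp only [criterion] at hopt
  simp_rw [hres] at hopt
  rw [hsq, hn2] at hopt
  have hR' : ∑ i, (y i - ∑ j, x i j * β j - f (t i)) ^ 2 = ∑ i, R i ^ 2 := rfl
  rw [hR'] at hopt
  have hn : 1 / (n : ℝ) = 2 * (1 / (2 * (n : ℝ))) := by
    rw [one_div, one_div, mul_inv]; ring
  rw [hn]
  have h5 := mul_le_mul_of_nonneg_left hl1 hl₁
  linarith

/-- The deterministic part: on the event that the empirical processes are small, the estimation
error satisfies the basic inequality. -/
theorem IsEstimator.basic_inequality [CompleteSpace H] {x : Fin n → Fin p → ℝ} {t : Fin n → 𝒯}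
    {y e : Fin n → ℝ} {lam₁ lam₂ L r C : ℝ} {βstar β : Fin p → ℝ} {fstar f : H}
    {g : Fin p → H} {S : Fin p → Fin p → ℝ} (hn : 0 < n) (hC : 0 < C) (hr : 0 < r)
    (hl₁ : (2 + 5 * L) * r ≤ lam₁) (hL : 0 ≤ L)
    (hy : ∀ i, y i = ∑ j, x i j * βstar j + fstar (t i) + e i)
    (hf : ‖f‖ ≤ C) (hfstar : ‖fstar‖ ≤ C)
    (hnoise : ∀ j, |∑ i, residual g (x i, t i) j * e i| ≤ n * (r / 2))
    (hrep : ∀ j, ‖∑ i, residual g (x i, t i) j • representer H (t i)‖ ≤ n * (r / (4 * C)))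
    (hproj : ∀ j k, |∑ i, residual g (x i, t i) j * g k (t i)| ≤ n * r)
    (hcov : ∀ j k, |∑ i, (residual g (x i, t i) j * residual g (x i, t i) k - S j k)| ≤ n * r)
    (hest : IsEstimator x t y lam₁ lam₂ βstar L β f) :
    ∑ j, ∑ k, (β - βstar) j * (β - βstar) k * S j k + lam₁ / 2 * l1Norm (β - βstar)
      ≤ 2 * lam₁ * ∑ j with βstar j ≠ 0, |(β - βstar) j|
        + lam₂ * inner ℝ f (∑ j, (β - βstar) j • g j) := by
  have hl₁0 : 0 ≤ lam₁ := le_trans (by positivity) hl₁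
  have hfo := hest.first_order hl₁0 g
  have hl1 := mul_le_mul_of_nonneg_left (l1Norm_sub_le β βstar) hl₁0
  have hδL := hest.1
  set δ := β - βstar with hδ
  have hδ0 := l1Norm_nonneg δ
  have hn' : (0 : ℝ) < n := by exact_mod_cast hn
  set d : Fin n → Fin p → ℝ := fun i => residual g (x i, t i) with hd
  have h1 := abs_sum_mul_le_l1Norm δ (fun j => ∑ i, d i j * e i) hnoise
  -- The reproducing property makes this inner product the sum of `d i j * (f - fstar) (t i)`. The
  -- threshold `r / (4 * C)` is chosen so that `2 * C` times it is `r / 2`.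
  have h2 : ∀ j, |inner ℝ (f - fstar) (∑ i, d i j • representer H (t i))| ≤ n * (r / 2) := by
    intro j
    refine (abs_real_inner_le_norm _ _).trans ?_
    have hh : ‖f - fstar‖ ≤ 2 * C := (norm_sub_le _ _).trans (by linarith)
    refine (mul_le_mul hh (hrep j) (norm_nonneg _) (by positivity)).trans (le_of_eq ?_)
    field_simp
    ring
  replace h2 := abs_sum_mul_le_l1Norm δ _ h2
  have h3 := abs_sum_sum_mul_le_l1Norm_sq δ (fun j k => ∑ i, d i j * g k (t i)) hproj
  have h4 := abs_sum_sum_mul_le_l1Norm_sq δ (fun j k => ∑ i, (d i j * d i k - S j k)) hcov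
  have hsum : ∑ i, (y i - ∑ j, x i j * β j - f (t i)) * (∑ j, δ j * d i j)
      = ∑ j, δ j * (∑ i, d i j * e i)
        - ∑ j, δ j * inner ℝ (f - fstar) (∑ i, d i j • representer H (t i))
        - ∑ j, ∑ k, δ j * δ k * (∑ i, d i j * g k (t i))
        - ∑ j, ∑ k, δ j * δ k * (∑ i, (d i j * d i k - S j k))
        - n * ∑ j, ∑ k, δ j * δ k * S j k := by
    have e1 : ∀ i, y i - ∑ j, x i j * β j - f (t i)
        = e i - (f - fstar) (t i) - ∑ k, δ k * g k (t i) - ∑ k, δ k * d i k := by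
      intro i
      have : ∑ j, x i j * β j = ∑ j, x i j * βstar j + ∑ k, δ k * g k (t i)
          + ∑ k, δ k * d i k := by
        rw [← Finset.sum_add_distrib, ← Finset.sum_add_distrib]
        refine Finset.sum_congr rfl fun j _ => ?_
        simp only [hδ, hd, residual, Pi.sub_apply]
        ring
      rw [hy, this, RKHS.coe_sub, Pi.sub_apply]
      ring
    have a1 : ∑ j, δ j * (∑ i, d i j * e i) = ∑ i, e i * ∑ j, δ j * d i j := by
      simp only [Finset.mul_sum]
      rw [Finset.sum_comm]
      exact Finset.sum_congr rfl fun _ _ => Finset.sum_congr rfl fun _ _ => by ring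
    have a2 : ∑ j, δ j * inner ℝ (f - fstar) (∑ i, d i j • representer H (t i))
        = ∑ i, (f - fstar) (t i) * ∑ j, δ j * d i j := by
      simp only [inner_sum, inner_smul_right, inner_representer, Finset.mul_sum]
      rw [Finset.sum_comm]
      exact Finset.sum_congr rfl fun _ _ => Finset.sum_congr rfl fun _ _ => by ring
    have a3 : ∑ j, ∑ k, δ j * δ k * (∑ i, d i j * g k (t i))
        = ∑ i, (∑ k, δ k * g k (t i)) * ∑ j, δ j * d i j := by
      simp only [Finset.mul_sum, Finset.sum_mul]
      rw [Finset.sum_comm' (t' := Finset.univ) (s' := fun _ => Finset.univ) (by simp)]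
      rw [Finset.sum_congr rfl fun _ _ => Finset.sum_comm, Finset.sum_comm]
      refine Finset.sum_congr rfl fun _ _ => ?_
      rw [Finset.sum_comm]
      exact Finset.sum_congr rfl fun _ _ => Finset.sum_congr rfl fun _ _ => by ring
    have a4 : ∑ j, ∑ k, δ j * δ k * (∑ i, (d i j * d i k - S j k))
        = ∑ i, (∑ k, δ k * d i k) * (∑ j, δ j * d i j) - n * ∑ j, ∑ k, δ j * δ k * S j k := by
      have b1 : ∀ j k, δ j * δ k * (∑ i, (d i j * d i k - S j k))
          = ∑ i, δ j * δ k * (d i j * d i k) - n * (δ j * δ k * S j k) := by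
        intro j k
        simp only [Finset.sum_sub_distrib, Finset.sum_const, Finset.card_univ, Fintype.card_fin,
          nsmul_eq_mul, Finset.mul_sum, mul_sub]
        ring
      rw [Finset.sum_congr rfl fun j _ => Finset.sum_congr rfl fun k _ => b1 j k]
      simp only [Finset.sum_sub_distrib, Finset.mul_sum, Finset.sum_mul]
      congr 1
      rw [Finset.sum_congr rfl fun _ _ => Finset.sum_comm, Finset.sum_comm]
      exact Finset.sum_congr rfl fun _ _ => Finset.sum_congr rfl fun _ _ =>
        Finset.sum_congr rfl fun _ _ => by ring
    rw [a1, a2, a3, a4]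
    simp only [e1, sub_mul, Finset.sum_sub_distrib]
    ring
  rw [hsum] at hfo
  obtain ⟨-, h1⟩ := abs_le.1 h1
  obtain ⟨h2, -⟩ := abs_le.1 h2
  obtain ⟨h3, -⟩ := abs_le.1 h3
  obtain ⟨h4, -⟩ := abs_le.1 h4
  set Q := ∑ j, ∑ k, δ j * δ k * S j k
  -- The noise and representer terms contribute `r / 2` each, times `l1Norm δ`; the projection and
  -- covariance terms contribute `r` each, times `l1Norm δ ^ 2`.
  have hup : 1 / (n : ℝ) * (∑ j, δ j * (∑ i, d i j * e i)
        - ∑ j, δ j * inner ℝ (f - fstar) (∑ i, d i j • representer H (t i))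
        - ∑ j, ∑ k, δ j * δ k * (∑ i, d i j * g k (t i))
        - ∑ j, ∑ k, δ j * δ k * (∑ i, (d i j * d i k - S j k)) - n * Q)
      ≤ l1Norm δ * r + 2 * (l1Norm δ ^ 2 * r) - Q := by
    rw [one_div, inv_mul_le_iff₀ hn']
    linarith
  -- The constraint `l1Norm δ ≤ L` makes the quadratic terms linear. The total `(1 + 2 * L) * r *
  -- l1Norm δ` is then at most `lam₁ / 2 * l1Norm δ`.
  have hsq : l1Norm δ ^ 2 * r ≤ l1Norm δ * L * r := by
    rw [sq]; gcongr
  have hlam : l1Norm δ * ((2 + 5 * L) * r) ≤ l1Norm δ * lam₁ := by gcongr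
  have hLr : 0 ≤ l1Norm δ * L * r := by positivity
  linarith

/-- With `B = 2 * lam₁ * a + lam₂ * A`, dropping the `l` term gives `N ≤ B`, while maximizing `B * N
- N ^ 2` over `N` gives `lam₁ / 2 * l ≤ B ^ 2 / 4`. -/
theorem error_bounds {N l a A lam₁ lam₂ : ℝ} (hl : 0 ≤ l) (hlam : 0 < lam₁)
    (ha : 0 ≤ a) (hA : 0 ≤ A) (hlam₂ : 0 ≤ lam₂)
    (h : N ^ 2 + lam₁ / 2 * l ≤ (2 * lam₁ * a + lam₂ * A) * N) :
    N ≤ 2 * a * lam₁ + lam₂ * A ∧ l ≤ 4 * a ^ 2 * lam₁ + A ^ 2 * (lam₂ ^ 2 / lam₁) := by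
  set B := 2 * lam₁ * a + lam₂ * A with hB
  have hB0 : 0 ≤ B := by positivity
  constructor
  · have h1 : N ^ 2 ≤ B * N := by nlinarith [mul_nonneg hlam.le hl]
    by_contra! hlt
    nlinarith
  · have h2 : lam₁ / 2 * l ≤ B ^ 2 / 4 := by nlinarith [sq_nonneg (N - B / 2)]
    have h3 : B ^ 2 ≤ 8 * lam₁ ^ 2 * a ^ 2 + 2 * lam₂ ^ 2 * A ^ 2 := by
      nlinarith [sq_nonneg (2 * lam₁ * a - lam₂ * A)]
    have h4 : l * lam₁ ≤ 4 * lam₁ ^ 2 * a ^ 2 + lam₂ ^ 2 * A ^ 2 := by linarith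
    rw [← le_div_iff₀ hlam] at h4
    refine h4.trans (le_of_eq ?_)
    field_simp

end Deterministic

/-! ### The good event and its probability -/

section Probability

variable {𝒯 H : Type*} [NormedAddCommGroup H] [InnerProductSpace ℝ H] [CompleteSpace H]
  [RKHS ℝ H 𝒯 ℝ] [MeasurableSpace 𝒯]

omit [CompleteSpace H] in
theorem Model.measurePreserving {Ω : Type*} [MeasurableSpace Ω] {n p : ℕ} {μ : Measure Ω}
    [IsProbabilityMeasure μ] {ρ : Measure ((Fin p → ℝ) × 𝒯)} [IsProbabilityMeasure ρ]
    {X : Fin n → Ω → Fin p → ℝ} {T : Fin n → Ω → 𝒯} {ε Y : Fin n → Ω → ℝ}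
    {βstar : Fin p → ℝ} {fstar : H} (hM : Model μ ρ X T ε Y βstar fstar) :
    MeasurePreserving (fun ω i => ((X i ω, T i ω), ε i ω)) μ
      (Measure.pi fun _ : Fin n => ρ.prod (gaussianReal 0 1)) := by
  have hZm : ∀ i, Measurable fun ω => (X i ω, T i ω) :=
    fun i => (hM.measurable_X i).prodMk (hM.measurable_T i)
  have h1 : μ.map (fun ω i => (X i ω, T i ω)) = Measure.pi fun _ => ρ := by
    rw [(iIndepFun_iff_map_fun_eq_pi_map fun i => (hZm i).aemeasurable).1 hM.indep_covariates]
    simp_rw [hM.law_covariates]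
  have h2 : μ.map (fun ω i => ε i ω) = Measure.pi fun _ => gaussianReal 0 1 := by
    rw [(iIndepFun_iff_map_fun_eq_pi_map
      fun i => (hM.measurable_noise i).aemeasurable).1 hM.indep_noise]
    simp_rw [hM.law_noise]
  have hm1 : Measurable fun ω i => (X i ω, T i ω) := measurable_pi_lambda _ hZm
  have hm2 : Measurable fun ω i => ε i ω := measurable_pi_lambda _ hM.measurable_noise
  have h3 : MeasurePreserving (fun ω => ((fun i => (X i ω, T i ω)), fun i => ε i ω)) μ
      ((Measure.pi fun _ => ρ).prod (Measure.pi fun _ => gaussianReal 0 1)) :=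
    ⟨hm1.prodMk hm2, by
      rw [(indepFun_iff_map_prod_eq_prod_map_map hm1.aemeasurable hm2.aemeasurable).1
        hM.indep_covariates_noise, h1, h2]⟩
  exact (measurePreserving_arrowProdEquivProdArrow _ _ (Fin n) (fun _ => ρ)
    (fun _ => gaussianReal 0 1)).symm.comp h3

omit [CompleteSpace H] in
theorem Model.measurePreserving_covariates {Ω : Type*} [MeasurableSpace Ω] {n p : ℕ}
    {μ : Measure Ω} [IsProbabilityMeasure μ] {ρ : Measure ((Fin p → ℝ) × 𝒯)}
    [IsProbabilityMeasure ρ] {X : Fin n → Ω → Fin p → ℝ} {T : Fin n → Ω → 𝒯}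
    {ε Y : Fin n → Ω → ℝ} {βstar : Fin p → ℝ} {fstar : H}
    (hM : Model μ ρ X T ε Y βstar fstar) :
    MeasurePreserving (fun ω i => (X i ω, T i ω)) μ (Measure.pi fun _ : Fin n => ρ) := by
  have hZm : ∀ i, Measurable fun ω => (X i ω, T i ω) :=
    fun i => (hM.measurable_X i).prodMk (hM.measurable_T i)
  refine ⟨measurable_pi_lambda _ hZm, ?_⟩
  rw [(iIndepFun_iff_map_fun_eq_pi_map fun i => (hZm i).aemeasurable).1 hM.indep_covariates]
  simp_rw [hM.law_covariates]

variable {p : ℕ} {ρ : Measure ((Fin p → ℝ) × 𝒯)} [IsProbabilityMeasure ρ] {g : Fin p → H}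
  {n : ℕ} {C C₀ : ℝ}

omit [IsProbabilityMeasure ρ] in
theorem measurable_inner_residual_smul_representer
    (hKm : Measurable fun st : 𝒯 × 𝒯 => kernel H st.1 st.2) (j : Fin p) (x : H) :
    Measurable fun z : (Fin p → ℝ) × 𝒯 => inner ℝ x (residual g z j • representer H z.2) := by
  simp only [inner_smul_right, inner_representer]
  exact (measurable_residual hKm g j).mul ((measurable_apply hKm x).comp measurable_snd)

theorem measurable_inner_smul_representer {Z : Type*} [MeasurableSpace Z] {w : Z → ℝ} {τ : Z → 𝒯}
    (hw : Measurable w) (hτ : Measurable τ)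
    (hKm : Measurable fun st : 𝒯 × 𝒯 => kernel H st.1 st.2) :
    Measurable fun q : Z × Z =>
      inner ℝ (w q.1 • representer H (τ q.1)) (w q.2 • representer H (τ q.2)) := by
  simp_rw [real_inner_smul_left, real_inner_smul_right, inner_representer_representer]
  have h1 : Measurable fun q : Z × Z => w q.1 := hw.comp measurable_fst
  have h2 : Measurable fun q : Z × Z => w q.2 := hw.comp measurable_snd
  have h4 : Measurable fun q : Z × Z => kernel H (τ q.1) (τ q.2) :=
    measurable_uncurry_comp (F := kernel H) hτ hKm
  exact Measurable.mul h1 (Measurable.mul h2 h4)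

omit [IsProbabilityMeasure ρ] in
theorem measurable_inner_residual_smul_representer_prod
    (hKm : Measurable fun st : 𝒯 × 𝒯 => kernel H st.1 st.2) (j : Fin p) :
    Measurable fun q : ((Fin p → ℝ) × 𝒯) × ((Fin p → ℝ) × 𝒯) =>
      inner ℝ (residual g q.1 j • representer H q.1.2) (residual g q.2 j • representer H q.2.2) := by
  exact measurable_inner_smul_representer (measurable_residual hKm g j) measurable_snd hKm

omit [IsProbabilityMeasure ρ] in
theorem measurableSet_le_norm_sum_representer
    (hKm : Measurable fun st : 𝒯 × 𝒯 => kernel H st.1 st.2) (g : Fin p → H) (j : Fin p) (u : ℝ) :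
    MeasurableSet {z : Fin n → (Fin p → ℝ) × 𝒯 |
      u ≤ ‖∑ i, residual g (z i) j • representer H (z i).2‖} := by
  refine measurableSet_le measurable_const ?_
  simpa using measurable_norm_add_sum (measurable_inner_residual_smul_representer (g := g) hKm j)
    (measurable_inner_residual_smul_representer_prod hKm j) n 0

theorem measure_representer_le (hKm : Measurable fun st : 𝒯 × 𝒯 => kernel H st.1 st.2)
    (hK : ∀ t : 𝒯, kernel H t t ≤ 1) (hC : 0 < C) {j : Fin p}
    (hR : ∀ᵐ z ∂ρ, |residual g z j| ≤ C) (hg : IsProjection ρ j (g j)) {u : ℝ} (hu : 0 ≤ u)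
    (hn : 0 < n) :
    (Measure.pi fun _ : Fin n => ρ).real
        {z | n * u ≤ ‖∑ i, residual g (z i) j • representer H (z i).2‖}
      ≤ 2 * Real.exp (-(n * u ^ 2 / (4 * C ^ 2))) := by
  refine measure_pi_le_norm_sum_le_of_bounded ρ
    (Φ := fun z => residual g z j • representer H z.2) hC hu
    (measurable_inner_residual_smul_representer hKm j)
    (measurable_inner_residual_smul_representer_prod hKm j) ?_ (fun x => ?_) hn
  · filter_upwards [hR] with z hz
    rw [norm_smul, Real.norm_eq_abs]
    exact (mul_le_of_le_one_right (abs_nonneg _) (norm_representer_le hK _)).trans hz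
  · simp only [inner_smul_right, inner_representer]
    exact hg.integral_mul_eq_zero hKm hK hR x

/-- The summands are centered by orthogonality, and `g k` at `T` is the difference of `X⁽ᵏ⁾` and its
residual, hence bounded by `C₀ + C`. -/
theorem measure_projection_le (hKm : Measurable fun st : 𝒯 × 𝒯 => kernel H st.1 st.2)
    (hK : ∀ t : 𝒯, kernel H t t ≤ 1) (hC : 0 < C) (hC₀ : 0 ≤ C₀) {j k : Fin p}
    (hX : ∀ j, ∀ᵐ z ∂ρ, |z.1 j| ≤ C₀)
    (hR : ∀ j, ∀ᵐ z ∂ρ, |residual g z j| ≤ C) (hg : IsProjection ρ j (g j)) {u : ℝ} (hu : 0 ≤ u)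
    (hn : 0 < n) :
    (Measure.pi fun _ : Fin n => ρ).real
        {z | n * u ≤ |∑ i, residual g (z i) j * g k (z i).2|}
      ≤ 2 * Real.exp (-(n * u ^ 2 / (4 * (C * (C₀ + C)) ^ 2))) := by
  refine measure_pi_le_abs_sum_le ρ (φ := fun z => residual g z j * g k z.2) (by positivity) hu
    ((measurable_residual hKm g j).mul ((measurable_apply hKm (g k)).comp measurable_snd)) ?_
    (hg.integral_mul_eq_zero hKm hK (hR j) (g k)) hn
  filter_upwards [hX k, hR j, hR k] with z h1 h2 h3
  rw [abs_mul]
  refine mul_le_mul h2 ?_ (abs_nonneg _) hC.le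
  have e : g k z.2 = z.1 k - residual g z k := by simp [residual]
  rw [e]
  exact (abs_sub _ _).trans (add_le_add h1 h3)

theorem measure_residualCov_le (hKm : Measurable fun st : 𝒯 × 𝒯 => kernel H st.1 st.2)
    (hC : 0 < C) {j k : Fin p} (hR : ∀ j, ∀ᵐ z ∂ρ, |residual g z j| ≤ C) {u : ℝ} (hu : 0 ≤ u)
    (hn : 0 < n) :
    (Measure.pi fun _ : Fin n => ρ).real
        {z | n * u ≤ |∑ i, (residual g (z i) j * residual g (z i) k - residualCov ρ g j k)|}
      ≤ 2 * Real.exp (-(n * u ^ 2 / (4 * (2 * C ^ 2) ^ 2))) := by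
  have hb : ∀ᵐ z ∂ρ, |residual g z j * residual g z k| ≤ C ^ 2 := by
    filter_upwards [hR j, hR k] with z h1 h2
    rw [abs_mul, sq]
    exact mul_le_mul h1 h2 (abs_nonneg _) hC.le
  have hS : |residualCov ρ g j k| ≤ C ^ 2 := by
    have := norm_integral_le_of_norm_le_const (μ := ρ)
      (f := fun z => residual g z j * residual g z k) hb
    simpa [residualCov] using this
  refine measure_pi_le_abs_sum_le ρ
    (φ := fun z => residual g z j * residual g z k - residualCov ρ g j k) (by positivity) hu
    (((measurable_residual hKm g j).mul (measurable_residual hKm g k)).sub_const _) ?_ ?_ hn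
  · filter_upwards [hb] with z hz
    exact (abs_sub _ _).trans (by linarith)
  · rw [integral_sub (integrable_residual_mul_residual hKm hR j k) (integrable_const _)]
    simp [residualCov]

/-- The event on which all empirical processes of the analysis are small. -/
theorem Model.exists_event {Ω : Type*} [MeasurableSpace Ω] {μ : Measure Ω}
    [IsProbabilityMeasure μ] {X : Fin n → Ω → Fin p → ℝ} {T : Fin n → Ω → 𝒯}
    {ε Y : Fin n → Ω → ℝ} {βstar : Fin p → ℝ} {fstar : H}
    (hKm : Measurable fun st : 𝒯 × 𝒯 => kernel H st.1 st.2)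
    (hK : ∀ t : 𝒯, kernel H t t ≤ 1) (hM : Model μ ρ X T ε Y βstar fstar)
    (hC : 0 < C) (hC₀ : 0 ≤ C₀) (hX : ∀ j, ∀ᵐ z ∂ρ, |z.1 j| ≤ C₀)
    (hR : ∀ j, ∀ᵐ z ∂ρ, |residual g z j| ≤ C) (hg : ∀ j, IsProjection ρ j (g j)) {r : ℝ}
    (hr : 0 < r) (hn : 0 < n) :
    ∃ E : Set Ω, MeasurableSet E ∧
      1 - p * (2 * Real.exp (-(n * (r / 2) ^ 2 / (2 * C ^ 2))))
        - p * (2 * Real.exp (-(n * (r / (4 * C)) ^ 2 / (4 * C ^ 2))))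
        - p ^ 2 * (2 * Real.exp (-(n * r ^ 2 / (4 * (C * (C₀ + C)) ^ 2))))
        - p ^ 2 * (2 * Real.exp (-(n * r ^ 2 / (4 * (2 * C ^ 2) ^ 2)))) ≤ μ.real E ∧
      ∀ ω ∈ E,
        (∀ j, |∑ i, residual g (X i ω, T i ω) j * ε i ω| ≤ n * (r / 2)) ∧
        (∀ j, ‖∑ i, residual g (X i ω, T i ω) j • representer H (T i ω)‖ ≤ n * (r / (4 * C))) ∧
        (∀ j k, |∑ i, residual g (X i ω, T i ω) j * g k (T i ω)| ≤ n * r) ∧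
        (∀ j k, |∑ i, (residual g (X i ω, T i ω) j * residual g (X i ω, T i ω) k
          - residualCov ρ g j k)| ≤ n * r) := by
  have hZ := hM.measurePreserving_covariates
  have hZe := hM.measurePreserving
  set ζ : Ω → Fin n → (Fin p → ℝ) × 𝒯 := fun ω i => (X i ω, T i ω) with hζ
  set ξ : Ω → Fin n → ((Fin p → ℝ) × 𝒯) × ℝ := fun ω i => ((X i ω, T i ω), ε i ω) with hξ
  -- The bad events: `A` for the noise, `B` for the representers, `D` for the projections, `F` for
  -- the covariance. Only `A` involves `ε`, so the others are pulled back from the covariates alone.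
  set A : Fin p → Set Ω := fun j => ξ ⁻¹' {z | n * (r / 2) ≤
    |∑ i, residual g (z i).1 j * (z i).2|} with hA
  set B : Fin p → Set Ω := fun j => ζ ⁻¹' {z | n * (r / (4 * C)) ≤
    ‖∑ i, residual g (z i) j • representer H (z i).2‖} with hB
  set D : Fin p × Fin p → Set Ω := fun q => ζ ⁻¹' {z | n * r ≤
    |∑ i, residual g (z i) q.1 * g q.2 (z i).2|} with hD
  set F : Fin p × Fin p → Set Ω := fun q => ζ ⁻¹' {z | n * r ≤
    |∑ i, (residual g (z i) q.1 * residual g (z i) q.2 - residualCov ρ g q.1 q.2)|} with hF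
  have hresm := fun j => measurable_residual (p := p) hKm g j
  have hAm' : ∀ j, MeasurableSet {z : Fin n → ((Fin p → ℝ) × 𝒯) × ℝ | n * (r / 2) ≤
      |∑ i, residual g (z i).1 j * (z i).2|} := fun j =>
    measurableSet_le_abs_sum (φ := fun z : ((Fin p → ℝ) × 𝒯) × ℝ => residual g z.1 j * z.2)
      (((hresm j).comp measurable_fst).mul measurable_snd) _
  have hBm' := fun j => measurableSet_le_norm_sum_representer (n := n) hKm g j (n * (r / (4 * C)))
  have hDm' : ∀ q : Fin p × Fin p, MeasurableSet {z : Fin n → (Fin p → ℝ) × 𝒯 | n * r ≤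
      |∑ i, residual g (z i) q.1 * g q.2 (z i).2|} := fun q =>
    measurableSet_le_abs_sum (φ := fun z : (Fin p → ℝ) × 𝒯 => residual g z q.1 * g q.2 z.2)
      ((hresm q.1).mul ((measurable_apply hKm (g q.2)).comp measurable_snd)) _
  have hFm' : ∀ q : Fin p × Fin p, MeasurableSet {z : Fin n → (Fin p → ℝ) × 𝒯 | n * r ≤
      |∑ i, (residual g (z i) q.1 * residual g (z i) q.2 - residualCov ρ g q.1 q.2)|} := fun q =>
    measurableSet_le_abs_sum (φ := fun z : (Fin p → ℝ) × 𝒯 =>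
      residual g z q.1 * residual g z q.2 - residualCov ρ g q.1 q.2)
      (((hresm q.1).mul (hresm q.2)).sub_const _) _
  have hAm : MeasurableSet (⋃ j, A j) := .iUnion fun j => hZe.measurable (hAm' j)
  have hBm : MeasurableSet (⋃ j, B j) := .iUnion fun j => hZ.measurable (hBm' j)
  have hDm : MeasurableSet (⋃ q, D q) := .iUnion fun q => hZ.measurable (hDm' q)
  have hFm : MeasurableSet (⋃ q, F q) := .iUnion fun q => hZ.measurable (hFm' q)
  have hAp : μ.real (⋃ j, A j) ≤ p * (2 * Real.exp (-(n * (r / 2) ^ 2 / (2 * C ^ 2)))) := by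
    rw [show (p : ℝ) = Fintype.card (Fin p) by simp]
    refine measureReal_iUnion_le_card_mul fun j => ?_
    rw [hA, hZe.measureReal_preimage (hAm' j).nullMeasurableSet]
    exact measure_pi_le_abs_sum_gaussian_le ρ hC (by positivity) (hresm j) (hR j)
  have hBp : μ.real (⋃ j, B j)
      ≤ p * (2 * Real.exp (-(n * (r / (4 * C)) ^ 2 / (4 * C ^ 2)))) := by
    rw [show (p : ℝ) = Fintype.card (Fin p) by simp]
    refine measureReal_iUnion_le_card_mul fun j => ?_
    rw [hB, hZ.measureReal_preimage (hBm' j).nullMeasurableSet]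
    exact measure_representer_le hKm hK hC (hR j) (hg j) (by positivity) hn
  have hDp : μ.real (⋃ q, D q)
      ≤ p ^ 2 * (2 * Real.exp (-(n * r ^ 2 / (4 * (C * (C₀ + C)) ^ 2)))) := by
    rw [show (p : ℝ) ^ 2 = Fintype.card (Fin p × Fin p) by simp [sq]]
    refine measureReal_iUnion_le_card_mul fun q => ?_
    rw [hD, hZ.measureReal_preimage (hDm' q).nullMeasurableSet]
    exact measure_projection_le hKm hK hC hC₀ hX hR (hg q.1) hr.le hn
  have hFp : μ.real (⋃ q, F q)
      ≤ p ^ 2 * (2 * Real.exp (-(n * r ^ 2 / (4 * (2 * C ^ 2) ^ 2)))) := by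
    rw [show (p : ℝ) ^ 2 = Fintype.card (Fin p × Fin p) by simp [sq]]
    refine measureReal_iUnion_le_card_mul fun q => ?_
    rw [hF, hZ.measureReal_preimage (hFm' q).nullMeasurableSet]
    exact measure_residualCov_le hKm hC hR hr.le hn
  refine ⟨((⋃ j, A j) ∪ (⋃ j, B j) ∪ (⋃ q, D q) ∪ (⋃ q, F q))ᶜ,
    (((hAm.union hBm).union hDm).union hFm).compl, ?_, ?_⟩
  · rw [probReal_compl_eq_one_sub (((hAm.union hBm).union hDm).union hFm)]
    have u1 := measureReal_union_le (μ := μ) ((⋃ j, A j) ∪ (⋃ j, B j) ∪ (⋃ q, D q)) (⋃ q, F q)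
    have u2 := measureReal_union_le (μ := μ) ((⋃ j, A j) ∪ (⋃ j, B j)) (⋃ q, D q)
    have u3 := measureReal_union_le (μ := μ) (⋃ j, A j) (⋃ j, B j)
    linarith
  · intro ω hω
    simp only [Set.compl_union, Set.mem_inter_iff, Set.mem_compl_iff, Set.mem_iUnion,
      not_exists] at hω
    obtain ⟨⟨⟨h1, h2⟩, h3⟩, h4⟩ := hω
    exact ⟨fun j => (not_le.1 (h1 j)).le, fun j => (not_le.1 (h2 j)).le,
      fun j k => (not_le.1 (h3 (j, k))).le, fun j k => (not_le.1 (h4 (j, k))).le⟩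

/-- The error bounds of the estimator follow from the basic inequality and the eigenvalue bounds. -/
theorem error_bounds_of_basic_inequality
    (hKm : Measurable fun st : 𝒯 × 𝒯 => kernel H st.1 st.2)
    (hR : ∀ j, ∀ᵐ z ∂ρ, |residual g z j| ≤ C) {Λmin ΛK lam₁ lam₂ : ℝ} (hp : 0 < p)
    (hmin : ∀ x ∈ spectrum ℝ (residualCov ρ g), Λmin ≤ x) (hΛ : 0 < Λmin)
    (hmax : ∀ x ∈ spectrum ℝ (Matrix.gram ℝ g), x ≤ ΛK) (hC : 0 ≤ C)
    (hl₁ : 0 < lam₁) (hl₂ : 0 ≤ lam₂) {b v : Fin p → ℝ} {f : H} (hf : ‖f‖ ≤ C)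
    {D : ℝ} (hD : 0 ≤ D)
    (h : ∑ j, ∑ k, v j * v k * residualCov ρ g j k + lam₁ / 2 * l1Norm v
      ≤ 2 * lam₁ * ∑ j with b j ≠ 0, |v j| + lam₂ * inner ℝ f (∑ j, v j • g j)) :
    residualNorm ρ g v ≤ 2 * √(sparsity b / Λmin) * lam₁ + 4 * √(ΛK / Λmin) * (C + D) * lam₂ ∧
      l1Norm v ≤ 4 * sparsity b / Λmin * lam₁
        + 4 * ΛK / Λmin * (C + D) ^ 2 * (lam₂ ^ 2 / lam₁) := by
  set N := residualNorm ρ g v with hNdef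
  have hN : 0 ≤ N := Real.sqrt_nonneg _
  have hNsq := residualNorm_sq (ρ := ρ) hKm hR v
  rw [← hNsq] at h
  have hgram : ∀ v : Fin p → ℝ, ∑ j, ∑ k, v j * v k * Matrix.gram ℝ g j k
      = ‖∑ j, v j • g j‖ ^ 2 := by
    intro v
    rw [← real_inner_self_eq_norm_sq]
    simp_rw [sum_inner, inner_sum, real_inner_smul_left, real_inner_smul_right,
      Matrix.gram_apply, mul_assoc]
  have hmaxq := quadraticForm_le_of_spectrum_le (Matrix.isHermitian_gram (𝕜 := ℝ) g) hmax
  simp only [hgram] at hmaxq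
  -- Testing the Gram form on the all-ones vector bounds a squared norm by `ΛK * p`.
  have hΛK : 0 ≤ ΛK := by
    have h1 := hmaxq (fun _ => 1)
    have h2 : 0 ≤ ΛK * p := by
      refine (sq_nonneg ‖∑ j : Fin p, (1 : ℝ) • g j‖).trans (h1.trans (le_of_eq ?_))
      simp
    exact nonneg_of_mul_nonneg_left h2 (by exact_mod_cast hp)
  have hv : √(∑ j, v j ^ 2) ≤ N / √Λmin := by
    rw [le_div_iff₀ (Real.sqrt_pos.2 hΛ), ← Real.sqrt_mul (Finset.sum_nonneg fun _ _ => sq_nonneg _)]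
    refine Real.sqrt_le_iff.2 ⟨hN, ?_⟩
    rw [hNsq, mul_comm]
    exact le_quadraticForm_of_le_spectrum (residualCov_isHermitian g) hmin v
  have hsupp : ∑ j with b j ≠ 0, |v j| ≤ √(sparsity b / Λmin) * N := by
    refine (sum_abs_support_le b v).trans ?_
    rw [Real.sqrt_div (Nat.cast_nonneg _), div_mul_eq_mul_div, mul_div_assoc]
    gcongr
  have hG : ‖∑ j, v j • g j‖ ≤ √(ΛK / Λmin) * N := by
    have h1 : ‖∑ j, v j • g j‖ ≤ √ΛK * √(∑ j, v j ^ 2) := by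
      rw [← Real.sqrt_mul hΛK]
      exact Real.le_sqrt_of_sq_le (hmaxq v)
    refine h1.trans ?_
    rw [Real.sqrt_div hΛK, div_mul_eq_mul_div, mul_div_assoc]
    gcongr
  have hin : inner ℝ f (∑ j, v j • g j) ≤ C * (√(ΛK / Λmin) * N) :=
    (real_inner_le_norm _ _).trans (mul_le_mul hf hG (norm_nonneg _) hC)
  have hκ := Real.sqrt_nonneg (ΛK / Λmin)
  have key := error_bounds (a := √(sparsity b / Λmin)) (A := C * √(ΛK / Λmin))
    (l1Norm_nonneg v) hl₁ (Real.sqrt_nonneg _) (by positivity) hl₂ (N := N) (by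
      have h1 := mul_le_mul_of_nonneg_left hsupp (by positivity : 0 ≤ 2 * lam₁)
      have h2 := mul_le_mul_of_nonneg_left hin hl₂
      linarith)
  rw [mul_pow, Real.sq_sqrt (by positivity), Real.sq_sqrt (by positivity)] at key
  -- The argument yields the sharper factor `C`; the stated bounds follow by enlarging it.
  have hCD : C ≤ 4 * (C + D) := by linarith
  have hCD2 : C ^ 2 ≤ 4 * (C + D) ^ 2 := by nlinarith [mul_nonneg hC hD]
  constructor
  · refine key.1.trans ?_
    have h1 : C * (√(ΛK / Λmin) * lam₂) ≤ 4 * (C + D) * (√(ΛK / Λmin) * lam₂) := by gcongr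
    linarith
  · refine key.2.trans ?_
    have h1 : C ^ 2 * (ΛK / Λmin * (lam₂ ^ 2 / lam₁))
        ≤ 4 * (C + D) ^ 2 * (ΛK / Λmin * (lam₂ ^ 2 / lam₁)) := by gcongr
    have e1 : 4 * ΛK / Λmin * (C + D) ^ 2 * (lam₂ ^ 2 / lam₁)
        = 4 * (C + D) ^ 2 * (ΛK / Λmin * (lam₂ ^ 2 / lam₁)) := by ring
    have e2 : 4 * (sparsity b : ℝ) / Λmin * lam₁ = 4 * (sparsity b / Λmin) * lam₁ := by ring
    rw [e1, e2]
    linarith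

end Probability

/-! ### Matching the stated probability and conclusion -/

/-- Comparison of the union bound with the stated probability, when the latter is positive. -/
theorem tail_sum_le {n p : ℕ} {C C₀ r : ℝ} (hp : 1 ≤ p) (hC : 0 < C) (hC₀ : 0 ≤ C₀)
    (h : 2 * (p : ℝ) ^ 2 * Real.exp (-(1 / 32 * n * r ^ 2 / (4 * C ^ 4))) ≤ 1) :
    p * (2 * Real.exp (-(n * (r / 2) ^ 2 / (2 * C ^ 2))))
        + p * (2 * Real.exp (-(n * (r / (4 * C)) ^ 2 / (4 * C ^ 2))))
        + p ^ 2 * (2 * Real.exp (-(n * r ^ 2 / (4 * (C * (C₀ + C)) ^ 2))))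
        + p ^ 2 * (2 * Real.exp (-(n * r ^ 2 / (4 * (2 * C ^ 2) ^ 2))))
      ≤ 2 * (p : ℝ) ^ 2 * Real.exp (-(1 / 32 * n * r ^ 2 / (C ^ 2 * (C₀ + C) ^ 2)))
        + 2 * (p : ℝ) ^ 2 * Real.exp (-(1 / 32 * n * r ^ 2 / (4 * C ^ 4)))
        + 3 * (p : ℝ) * Real.exp (-(1 / 32 * n * r ^ 2 / C ^ 2)) := by
  have hp' : (1 : ℝ) ≤ p := by exact_mod_cast hp
  have hw : (0 : ℝ) ≤ n * r ^ 2 := by positivity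
  set y := Real.exp (-(1 / 32 * n * r ^ 2 / (4 * C ^ 4))) with hy
  have hy0 : 0 < y := Real.exp_pos _
  -- The constant `1 / 32` is chosen to make `y ^ 2` exactly the exponential in the representer
  -- bound, whose exponent is `n * r ^ 2 / (64 * C ^ 4)`.
  have hy2 : y ^ 2 = Real.exp (-(n * r ^ 2 / C ^ 4 * (1 / 64))) := by
    rw [hy, ← Real.exp_nat_mul]
    congr 1
    field_simp
    ring
  have e1 : Real.exp (-(n * (r / 2) ^ 2 / (2 * C ^ 2)))
      ≤ Real.exp (-(1 / 32 * n * r ^ 2 / C ^ 2)) := by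
    refine Real.exp_le_exp.2 (neg_le_neg ?_)
    have a1 : 1 / 32 * n * r ^ 2 / C ^ 2 = n * r ^ 2 / C ^ 2 * (1 / 32) := by ring
    have a2 : n * (r / 2) ^ 2 / (2 * C ^ 2) = n * r ^ 2 / C ^ 2 * (1 / 8) := by
      field_simp; ring
    rw [a1, a2]
    gcongr
    norm_num
  have e2 : Real.exp (-(n * (r / (4 * C)) ^ 2 / (4 * C ^ 2))) ≤ y ^ 2 := by
    rw [hy2]
    refine Real.exp_le_exp.2 (neg_le_neg (le_of_eq ?_))
    field_simp
    ring
  have e3 : Real.exp (-(n * r ^ 2 / (4 * (C * (C₀ + C)) ^ 2)))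
      ≤ Real.exp (-(1 / 32 * n * r ^ 2 / (C ^ 2 * (C₀ + C) ^ 2))) := by
    refine Real.exp_le_exp.2 (neg_le_neg ?_)
    have a1 : 1 / 32 * n * r ^ 2 / (C ^ 2 * (C₀ + C) ^ 2)
        = n * r ^ 2 / (C ^ 2 * (C₀ + C) ^ 2) * (1 / 32) := by ring
    have a2 : n * r ^ 2 / (4 * (C * (C₀ + C)) ^ 2)
        = n * r ^ 2 / (C ^ 2 * (C₀ + C) ^ 2) * (1 / 4) := by
      field_simp
    rw [a1, a2]
    gcongr
    norm_num
  have e4 : Real.exp (-(n * r ^ 2 / (4 * (2 * C ^ 2) ^ 2))) ≤ y ^ 2 := by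
    rw [hy2]
    refine Real.exp_le_exp.2 (neg_le_neg ?_)
    have a2 : n * r ^ 2 / (4 * (2 * C ^ 2) ^ 2) = n * r ^ 2 / C ^ 4 * (1 / 16) := by
      field_simp; ring
    rw [a2]
    gcongr
    norm_num
  have f1 : p * (2 * Real.exp (-(n * (r / 2) ^ 2 / (2 * C ^ 2))))
      ≤ 3 * (p : ℝ) * Real.exp (-(1 / 32 * n * r ^ 2 / C ^ 2)) := by
    have := Real.exp_pos (-(1 / 32 * n * r ^ 2 / C ^ 2))
    nlinarith
  have hpp : (p : ℝ) ≤ p ^ 2 := by nlinarith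
  have f2 : p * (2 * Real.exp (-(n * (r / (4 * C)) ^ 2 / (4 * C ^ 2)))) ≤ p ^ 2 * (2 * y ^ 2) := by
    gcongr
  have f3 : (p : ℝ) ^ 2 * (2 * Real.exp (-(n * r ^ 2 / (4 * (C * (C₀ + C)) ^ 2))))
      ≤ 2 * (p : ℝ) ^ 2 * Real.exp (-(1 / 32 * n * r ^ 2 / (C ^ 2 * (C₀ + C) ^ 2))) := by
    rw [← mul_assoc, mul_comm ((p : ℝ) ^ 2) 2]
    gcongr
  have f4 : (p : ℝ) ^ 2 * (2 * Real.exp (-(n * r ^ 2 / (4 * (2 * C ^ 2) ^ 2))))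
      ≤ p ^ 2 * (2 * y ^ 2) := by gcongr
  -- The representer and covariance terms together cost `4 * p ^ 2 * y ^ 2` against a budget of `2 *
  -- p ^ 2 * y`. The hypothesis `h` with `p ≥ 1` gives `2 * y ≤ 1`, which closes the gap.
  have f5 : 2 * ((p : ℝ) ^ 2 * (2 * y ^ 2)) ≤ 2 * (p : ℝ) ^ 2 * y := by
    have h1 : 2 * (p : ℝ) ^ 2 * y * (2 * y) ≤ 1 * (2 * y) := by gcongr
    nlinarith
  linarith

end PLM

end

theorem theorem2 :
    ∃ N₀ c : ℝ, 0 < N₀ ∧ 0 < c ∧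
    ∀ (q : ℕ) (𝒯 : Set (EuclideanSpace ℝ (Fin q))), IsCompact 𝒯 →
    ∀ (H : Type*) [NormedAddCommGroup H] [InnerProductSpace ℝ H] [CompleteSpace H]
      [RKHS ℝ H 𝒯 ℝ],
      Measurable (fun st : 𝒯 × 𝒯 => PLM.kernel H st.1 st.2) →
      (∀ t : 𝒯, PLM.kernel H t t ≤ 1) →
    ∀ (Ω : Type*) [MeasurableSpace Ω] (μ : Measure Ω) [IsProbabilityMeasure μ] (n p : ℕ)
      (ρ : Measure ((Fin p → ℝ) × 𝒯)) [IsProbabilityMeasure ρ]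
      (X : Fin n → Ω → Fin p → ℝ) (T : Fin n → Ω → 𝒯) (ε Y : Fin n → Ω → ℝ)
      (βstar : Fin p → ℝ) (fstar : H),
      PLM.Model μ ρ X T ε Y βstar fstar →
    ∀ (C₀ CK : ℝ) (g : Fin p → H) (Λmin ΛK : ℝ),
      (∀ j, ∀ᵐ z ∂ρ, |z.1 j| ≤ C₀) →
      (∀ j, PLM.IsProjection ρ j (g j)) →
      (∀ j, ∀ᵐ z ∂ρ, |PLM.residual g z j| ≤ CK) →
      ‖fstar‖ ≤ CK →
      IsLeast (spectrum ℝ (PLM.residualCov ρ g)) Λmin → 0 < Λmin →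
      IsGreatest (spectrum ℝ (Matrix.gram ℝ g)) ΛK →
    ∀ (r L lam₁ lam₂ : ℝ), 0 < r → 0 ≤ L → 0 ≤ lam₂ →
      (2 + 5 * L) * r + 8 * N₀ * CK * √((CK + 2) / n) + 4 * CK ^ 2 * r ≤ lam₁ →
      lam₂ * ΛK / Λmin ≤ 1 / 2 →
    ∃ E : Set Ω, MeasurableSet E ∧
      1 - 2 * (p : ℝ) ^ 2 * Real.exp (-(c * n * r ^ 2 / (CK ^ 2 * (C₀ + CK) ^ 2)))
        - 2 * (p : ℝ) ^ 2 * Real.exp (-(c * n * r ^ 2 / (4 * CK ^ 4)))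
        - 3 * (p : ℝ) * Real.exp (-(c * n * r ^ 2 / CK ^ 2))
        - (p : ℝ) * Real.exp (-(n * r ^ 2)) ≤ μ.real E ∧
      ∀ ω ∈ E, ∀ (β : Fin p → ℝ) (f : H),
        PLM.IsEstimator (fun i => X i ω) (fun i => T i ω) (fun i => Y i ω)
          lam₁ lam₂ βstar L β f →
        ‖f‖ ≤ CK →
        PLM.residualNorm ρ g (β - βstar) ≤
            2 * √(PLM.sparsity βstar / Λmin) * lam₁
              + 4 * √(ΛK / Λmin) * (CK + ‖fstar‖) * lam₂ ∧
          PLM.l1Norm (β - βstar) ≤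
            4 * PLM.sparsity βstar / Λmin * lam₁
              + 4 * ΛK / Λmin * (CK + ‖fstar‖) ^ 2 * (lam₂ ^ 2 / lam₁) := by
  -- Any positive `N₀` would do, as its term only enlarges `lam₁`; `1 / 32` comes from
  -- `tail_sum_le`.
  refine ⟨1, 1 / 32, one_pos, by norm_num, ?_⟩
  intro q 𝒯 _ H _ _ _ _ hKm hK Ω _ μ _ n p ρ _ X T ε Y βstar fstar hM C₀ CK g Λmin ΛK hX hg hR
    hfstar hmin hΛ hmax r L lam₁ lam₂ hr hL hl₂ hl₁ _
  -- If the claimed probability is not positive, the empty event suffices. Otherwise its positivity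
  -- excludes the degenerate cases and supplies the hypothesis of `tail_sum_le`.
  by_cases htriv : 1 - 2 * (p : ℝ) ^ 2
        * Real.exp (-(1 / 32 * n * r ^ 2 / (CK ^ 2 * (C₀ + CK) ^ 2)))
        - 2 * (p : ℝ) ^ 2 * Real.exp (-(1 / 32 * n * r ^ 2 / (4 * CK ^ 4)))
        - 3 * (p : ℝ) * Real.exp (-(1 / 32 * n * r ^ 2 / CK ^ 2))
        - (p : ℝ) * Real.exp (-(n * r ^ 2)) ≤ 0
  · exact ⟨∅, .empty, by simpa using htriv, by simp⟩
  rw [not_le] at htriv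
  -- A matrix of size zero has empty spectrum, hence no least eigenvalue.
  have hp : 0 < p := by
    rcases Nat.eq_zero_or_pos p with rfl | hp
    · exact absurd hmin.1 (by simp [spectrum.of_subsingleton])
    · exact hp
  have hp' : (1 : ℝ) ≤ p := by exact_mod_cast hp
  have t1 : 0 ≤ 2 * (p : ℝ) ^ 2
      * Real.exp (-(1 / 32 * n * r ^ 2 / (CK ^ 2 * (C₀ + CK) ^ 2))) := by positivity
  have t2 : 0 ≤ 2 * (p : ℝ) ^ 2 * Real.exp (-(1 / 32 * n * r ^ 2 / (4 * CK ^ 4))) := by positivity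
  have t3 : 0 ≤ 3 * (p : ℝ) * Real.exp (-(1 / 32 * n * r ^ 2 / CK ^ 2)) := by positivity
  have t4 : 0 ≤ (p : ℝ) * Real.exp (-(n * r ^ 2)) := by positivity
  have hCK0 : 0 ≤ CK := (norm_nonneg _).trans hfstar
  -- For `CK = 0` the divisions by zero return `0`, so the first three exponentials equal `1` and
  -- the claimed probability is negative. The case `n = 0` fails likewise.
  have hCK : 0 < CK := by
    refine hCK0.lt_of_ne fun h => ?_
    rw [← h] at htriv t1 t2 t3
    norm_num at htriv
    nlinarith
  have hn : 0 < n := by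
    rcases Nat.eq_zero_or_pos n with rfl | hn
    · norm_num at htriv
      nlinarith
    · exact hn
  have hC₀ : 0 ≤ C₀ := by
    obtain ⟨z, hz⟩ := (hX ⟨0, hp⟩).exists
    exact (abs_nonneg _).trans hz
  have hlr : (2 + 5 * L) * r ≤ lam₁ := by
    refine le_trans ?_ hl₁
    have : 0 ≤ 8 * 1 * CK * √((CK + 2) / n) := by positivity
    have : 0 ≤ 4 * CK ^ 2 * r := by positivity
    linarith
  have hl₁pos : 0 < lam₁ := lt_of_lt_of_le (by positivity) hlr
  obtain ⟨E, hE, hprob, hgood⟩ := hM.exists_event hKm hK hCK hC₀ hX hR hg hr hn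
  refine ⟨E, hE, ?_, ?_⟩
  · refine le_trans ?_ hprob
    have := PLM.tail_sum_le (n := n) (r := r) hp hCK hC₀ (by linarith)
    linarith
  · intro ω hω β f hest hf
    obtain ⟨h1, h2, h3, h4⟩ := hgood ω hω
    exact PLM.error_bounds_of_basic_inequality hKm hR hp (fun x hx => hmin.2 hx) hΛ
      (fun x hx => hmax.2 hx) hCK0 hl₁pos hl₂ hf (norm_nonneg _)
      (hest.basic_inequality hn hCK hr hlr hL (fun i => hM.response i ω) hf hfstar h1 h2 h3 h4)
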